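/- Let $n\ge 1$, $1\le p<\infty$, $0<\theta\le\infty$. For $q\in(0,\infty]$, a measurable set $A$ and a measurable $w\ge 0$ put $\|f\|_{q,w,A}=\big(\int_A|f|^q w\,dx\big)^{1/q}$ if $q<\infty$ and $\|f\|_{\infty,w,A}=\operatorname{ess\,sup}_A |f|w$, and write $\|f\|_{q,A}$ when $w\equiv1$. For $q\ge 1$ let $q'$ be the conjugate exponent, $1/q+1/q'=1$. Let $B(0,t)$ be the open Euclidean ball of radius $t$ centred at $0$ in $\mathbb{R}^n$. Let $v$ be a weight on $\mathbb{R}^n$ (measurable, positive and finite a.e.), and let $\omega:(0,\infty)\to[0,\infty]$ be measurable with $0<\|\omega\|_{\theta,(0,t)}<\infty$ for all $t>0$. Let $X={}^{c}LM_{p\theta,\omega}(\mathbb{R}^n,v)$ be the weighted complementary local Morrey-type space, with $$\|g\|_X=\Big\|\,\omega(r)\,\|g\|_{p,v,\mathbb{R}^n\setminus B(0,r)}\Big\|_{\theta,(0,\infty)},$$ and for measurable $f$ on $\mathbb{R}^n$ let $$\|f\|_{X'}=\sup\Big\{\int_{\mathbb{R}^n}|f(x)g(x)|\,dx:\ g \text{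 measurable},\ \|g\|_X\le 1\Big\}$$ be its associate norm. Below, $\|f\|_{p',v^{1-p'},A}$ is understood as $\|f\,v^{-1}\|_{\infty,A}$ when $p=1$; the usual conventions $0\cdot\infty=0$, $1/\infty=0$, $\infty/\infty=0$ are in force; and $\approx$ means that each side is at most a positive finite constant times the other (both sides may be infinite). (i) If $0<\theta\le 1$, then $$\|f\|_{X'}\approx\sup_{t\in(0,\infty)}\|f\|_{p',v^{1-p'},B(0,t)}\,\|\omega\|_{\theta,(0,t)}^{-1},$$ with positive constants in the equivalence independent of $f$. (ii) If $1<\theta\le\infty$, then $$\|f\|_{X'}\approx\Big(\int_{(0,\infty)}\|f\|_{p',v^{1-p'},B(0,t)}^{\theta'}\,d\big(-\|\omega\|_{\theta,(0,t+)}^{-\theta'}\big)\Big)^{1/\theta'}+\frac{\|f\|_{p',v^{1-p'},\mathbb{R}^n}}{\|\omega\|_{\theta,(0,\infty)}},$$ with positive constants in the equivalence independent of $f$, where $\|\omega\|_{\theta,(0,t+)}=\lim_{s\to t+}\|\omega\|_{\theta,(0,s)}$ and the integral is the Lebesgue–Stieltjes integral with respect to the non-decreasing function $t\mapsto-\|\omega\|_{\theta,(0,t+)}^{-\theta'}$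 on $(0,\infty)$. -/

import Mathlib

open Set MeasureTheory
open scoped ENNReal NNReal

noncomputable section

namespace MorreyType

/-- `ℝⁿ` with the Euclidean norm. -/
abbrev Rn (n : ℕ) : Type := EuclideanSpace ℝ (Fin n)

/-- The weighted functional `‖g‖_{p,A,w}` of a nonnegative function `g`:
`(∫_A g ^ p * w) ^ (1 / p)` for `p < ∞`, and `ess sup_A (g * w)` for `p = ∞`.
For a signed function `f` it is applied to `|f|`. -/
def wNorm {α : Type*} [MeasureSpace α] (p : ℝ≥0∞) (A : Set α) (w g : α → ℝ≥0∞) : ℝ≥0∞ :=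
  if p = ∞ then essSup (fun x => g x * w x) (volume.restrict A)
  else (∫⁻ x in A, g x ^ p.toReal * w x) ^ (1 / p.toReal)

/-- The class of weights on `ℝⁿ`: measurable, positive and finite almost everywhere. -/
def IsWeight {n : ℕ} (v : Rn n → ℝ≥0∞) : Prop :=
  AEMeasurable v ∧ ∀ᵐ x, 0 < v x ∧ v x < ∞

/-- `‖ω‖_{θ,(0,t)}`, without weight. -/
def headNorm (θ : ℝ≥0∞) (ω : ℝ → ℝ≥0∞) (t : ℝ) : ℝ≥0∞ :=
  wNorm θ (Ioo 0 t) 1 ω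

/-- The class `ᶜΩ_θ` of measurable `ω : (0,∞) → [0,∞]` with
`0 < ‖ω‖_{θ,(0,t)} < ∞` for all `t > 0`. (Only the values of `ω` on `(0,∞)` matter.) -/
def OmegaCompl (θ : ℝ≥0∞) (ω : ℝ → ℝ≥0∞) : Prop :=
  AEMeasurable ω (volume.restrict (Ioi 0)) ∧
    ∀ t : ℝ, 0 < t → 0 < headNorm θ ω t ∧ headNorm θ ω t < ∞

/-- The functional of the weighted complementary local Morrey-type space:
`‖ ω(r) ‖g‖_{p,v,ℝⁿ \ B(0,r)} ‖_{θ,(0,∞)}`. -/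
def complMorreyNorm {n : ℕ} (p θ : ℝ≥0∞) (ω : ℝ → ℝ≥0∞) (v : Rn n → ℝ≥0∞)
    (g : Rn n → EReal) : ℝ≥0∞ :=
  wNorm θ (Ioi (0 : ℝ)) 1
    (fun r => ω r * wNorm p (Metric.ball (0 : Rn n) r)ᶜ v (fun x => (g x).abs))

/-- The associate functional `sup { ∫ |f g| : ‖g‖_X ≤ 1 }` of a functional `‖·‖_X` on the
(extended real valued, Lebesgue) measurable functions on `ℝⁿ`. -/
def associateNorm {n : ℕ} (normX : (Rn n → EReal) → ℝ≥0∞) (f : Rn n → EReal) : ℝ≥0∞ :=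
  ⨆ (g : Rn n → EReal) (_ : AEMeasurable g) (_ : normX g ≤ 1), ∫⁻ x, (f x * g x).abs

/-- The weight `v ^ (1 - p')`, read as `v⁻¹` when `p = 1` (so that
`‖f‖_{p', v^{1-p'}, A}` is the unweighted `L_{p'}(A)` norm of `f v^{-1/p}` for all `p ≥ 1`). -/
def dualWeight {n : ℕ} (p : ℝ≥0∞) (v : Rn n → ℝ≥0∞) : Rn n → ℝ≥0∞ :=
  fun x => if p = 1 then (v x)⁻¹ else v x ^ (1 - p.conjExponent.toReal)

/-- `‖f‖_{p', v^{1-p'}, A}`. -/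
def dualNorm {n : ℕ} (p : ℝ≥0∞) (v : Rn n → ℝ≥0∞) (A : Set (Rn n)) (f : Rn n → EReal) :
    ℝ≥0∞ :=
  wNorm p.conjExponent A (dualWeight p v) (fun x => (f x).abs)

instance compactIccSpace_Ioi : CompactIccSpace (Ioi (0 : ℝ)) where
  isCompact_Icc := by
    intro a b
    rw [Subtype.isCompact_iff]
    have h : ((↑) : Ioi (0 : ℝ) → ℝ) '' Icc a b = Icc (a : ℝ) b := by
      ext x
      constructor
      · rintro ⟨y, hy, rfl⟩
        exact hy
      · intro hx
        exact ⟨⟨x, lt_of_lt_of_le a.2 hx.1⟩, hx, rfl⟩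
    rw [h]
    exact isCompact_Icc

open scoped Classical in
/-- The Lebesgue-Stieltjes measure `dφ` on `(0,∞)` of a non-decreasing finite function `φ` on
`(0,∞)`; it is determined by `dφ((y,z]) = φ(z+) - φ(y+)`. (Zero if `φ` is not monotone.) -/
def stieltjesMeasure (φ : Ioi (0 : ℝ) → ℝ) : Measure (Ioi (0 : ℝ)) :=
  if h : Monotone φ then h.stieltjesFunction.measure else 0

theorem stieltjesMeasure_Ioc {φ : Ioi (0 : ℝ) → ℝ} (h : Monotone φ) (y z : Ioi (0 : ℝ)) :
    stieltjesMeasure φ (Ioc y z) =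
      ENNReal.ofReal (Function.rightLim φ z - Function.rightLim φ y) := by
  rw [stieltjesMeasure, dif_pos h, StieltjesFunction.measure_Ioc]
  rfl

/-- `‖ω‖_{θ,(0,t+)} = lim_{s → t+} ‖ω‖_{θ,(0,s)}`. -/
def headNormRight (θ : ℝ≥0∞) (ω : ℝ → ℝ≥0∞) (t : ℝ) : ℝ≥0∞ :=
  Function.rightLim (headNorm θ ω) t

/-- The function `t ↦ -‖ω‖_{θ,(0,t+)}^{-θ'}` on `(0,∞)`; it is finite and non-decreasing for
`ω ∈ ᶜΩ_θ` and `θ > 1`. -/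
def negHeadPower (θ : ℝ≥0∞) (ω : ℝ → ℝ≥0∞) (t : Ioi (0 : ℝ)) : ℝ :=
  -(headNormRight θ ω t).toReal ^ (-θ.conjExponent.toReal)

theorem headNorm_mono (θ : ℝ≥0∞) (ω : ℝ → ℝ≥0∞) : Monotone (headNorm θ ω) := by
  intro s t hst
  have hm : (volume : Measure ℝ).restrict (Ioo 0 s) ≤ volume.restrict (Ioo 0 t) :=
    Measure.restrict_mono (Ioo_subset_Ioo_right hst) le_rfl
  unfold headNorm wNorm
  split_ifs with h
  · exact essSup_mono_measure (Measure.absolutelyContinuous_of_le hm)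
  · exact ENNReal.rpow_le_rpow (lintegral_mono' hm le_rfl) (by positivity)

theorem tendsto_headNormRight (θ : ℝ≥0∞) (ω : ℝ → ℝ≥0∞) (t : ℝ) :
    Filter.Tendsto (headNorm θ ω) (nhdsWithin t (Ioi t)) (nhds (headNormRight θ ω t)) :=
  (headNorm_mono θ ω).tendsto_rightLim t

theorem headNormRight_pos_lt_top {θ : ℝ≥0∞} {ω : ℝ → ℝ≥0∞} (hω : OmegaCompl θ ω) {t : ℝ}
    (ht : 0 < t) : 0 < headNormRight θ ω t ∧ headNormRight θ ω t < ∞ :=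
  ⟨(hω.2 t ht).1.trans_le ((headNorm_mono θ ω).le_rightLim le_rfl),
    ((headNorm_mono θ ω).rightLim_le (lt_add_one t)).trans_lt (hω.2 (t + 1) (by linarith)).2⟩

theorem negHeadPower_mono {θ : ℝ≥0∞} {ω : ℝ → ℝ≥0∞} (hω : OmegaCompl θ ω) :
    Monotone (negHeadPower θ ω) := by
  intro s t hst
  have hs := headNormRight_pos_lt_top hω s.2
  have ht := headNormRight_pos_lt_top hω t.2
  have h1 : (headNormRight θ ω s).toReal ≤ (headNormRight θ ω t).toReal :=
    ENNReal.toReal_mono ht.2.ne ((headNorm_mono θ ω).rightLim hst)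
  exact neg_le_neg (Real.rpow_le_rpow_of_nonpos (ENNReal.toReal_pos hs.1.ne' hs.2.ne) h1
    (neg_nonpos.2 ENNReal.toReal_nonneg))

end MorreyType

end

/-! Put `h = |f| v^{-1/p}`, `k = |g| v^{1/p}`, `ρ(x) = ‖x‖` and `W(t) = ‖ω‖_{θ,(0,t)}`. The weight
disappears, and the question becomes how large `∫ h k` can be when `‖ω(r) ‖k‖_{p,{r ≤ ρ}}‖_θ ≤ 1`.
This uses only that the measure is σ-finite and, where level sets of `ρ` matter, that these are
null.

Everything is discretized along the shells `2^j < W ≤ 2^(j+1)`. A tail norm is non-increasing in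
`r`, and `ω` carries a fixed share of its mass between the levels `2^(j-1)` and `W(s)` for `s` in
shell `j`. Hence the norm of `k` dominates the `ℓ^θ` norm of `2^j ‖k‖_{p, shell j}`
(`exists_eLpNorm_shells_le`). Hölder on each shell, followed by `ℓ^θ ⊆ ℓ^1` if `θ ≤ 1` or by Hölder
in `ℓ^θ` if `θ > 1`, bounds `∫ h k` from above.

From below, if `θ ≤ 1` it suffices to test with functions supported in one ball
(`eLpNorm_ball_le_mul_headNorm`). If `θ > 1`, near-extremal functions for the sets `{W ∘ ρ ≤ 2^j}`
are superposed with coefficients `2^{-j} d_j`, where `d` lies in the unit ball of `ℓ^θ`. A discrete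
Hardy inequality controls the norm of the sum (`eLpNorm_sublevelNorm_le`).

For `θ > 1` both bounds involve the `ℓ^θ'` norm of `2^{-j} ‖h‖_{p',{W ∘ ρ ≤ 2^j}}`. The Stieltjes
measure is the image of Lebesgue measure under the generalized inverse of `-W(t+)^{-θ'}`. Cutting
the negative half-line at the points `-2^{-jθ'}` compares the integral with that sum. Levels that
are never reached because `W` is bounded are accounted for by the term with `‖ω‖_{θ,(0,∞)}`. -/

namespace MorreyType

/-! ### Lebesgue norms of nonnegative functions: Hölder and its converse, Minkowski, exhaustion. -/

section LpBasics

variable {α : Type*} [MeasurableSpace α] {μ : Measure α}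

theorem eLpNorm_ennreal_eq {p : ℝ≥0∞} (hp0 : p ≠ 0) (hp : p ≠ ∞) (g : α → ℝ≥0∞) :
    eLpNorm g p μ = (∫⁻ x, g x ^ p.toReal ∂μ) ^ (1 / p.toReal) := by
  simp [eLpNorm_eq_lintegral_rpow_enorm_toReal hp0 hp]

theorem eLpNorm_ennreal_rpow {p : ℝ≥0∞} (hp0 : p ≠ 0) (hp : p ≠ ∞) (g : α → ℝ≥0∞) :
    eLpNorm g p μ ^ p.toReal = ∫⁻ x, g x ^ p.toReal ∂μ := by
  have : p.toReal ≠ 0 := (ENNReal.toReal_pos hp0 hp).ne'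
  rw [eLpNorm_ennreal_eq hp0 hp, ← ENNReal.rpow_mul, one_div_mul_cancel this, ENNReal.rpow_one]

theorem eLpNorm_ennreal_top (g : α → ℝ≥0∞) : eLpNorm g ∞ μ = essSup g μ := by
  simp [eLpNorm_exponent_top, eLpNormEssSup]

theorem eLpNorm_ennreal_one (g : α → ℝ≥0∞) : eLpNorm g 1 μ = ∫⁻ x, g x ∂μ := by
  simp [eLpNorm_one_eq_lintegral_enorm]

theorem eLpNorm_ennreal_mono {p : ℝ≥0∞} {f g : α → ℝ≥0∞} (h : ∀ᵐ x ∂μ, f x ≤ g x) :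
    eLpNorm f p μ ≤ eLpNorm g p μ :=
  eLpNorm_mono_enorm_ae (by simpa using h)

theorem ae_le_eLpNorm_top (g : α → ℝ≥0∞) : ∀ᵐ x ∂μ, g x ≤ eLpNorm g ∞ μ := by
  rw [eLpNorm_ennreal_top]
  exact ENNReal.ae_le_essSup g

theorem eLpNorm_top_le {g : α → ℝ≥0∞} {c : ℝ≥0∞} (h : ∀ᵐ x ∂μ, g x ≤ c) :
    eLpNorm g ∞ μ ≤ c := by
  rw [eLpNorm_ennreal_top]
  exact essSup_le_of_ae_le c h

theorem eLpNorm_restrict_mono {p : ℝ≥0∞} {s t : Set α} (g : α → ℝ≥0∞) (h : s ⊆ t) :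
    eLpNorm g p (μ.restrict s) ≤ eLpNorm g p (μ.restrict t) :=
  eLpNorm_mono_measure g (Measure.restrict_mono h le_rfl)

theorem eLpNorm_restrict_mono_ae {p : ℝ≥0∞} {s t : Set α} (g : α → ℝ≥0∞) (h : s ≤ᵐ[μ] t) :
    eLpNorm g p (μ.restrict s) ≤ eLpNorm g p (μ.restrict t) :=
  eLpNorm_mono_measure g (Measure.restrict_mono_ae h)

theorem toReal_holderConjugate {p q : ℝ≥0∞} [hpq : ENNReal.HolderConjugate p q] (hp : p ≠ ∞)
    (hq : q ≠ ∞) : p.toReal.HolderConjugate q.toReal := by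
  have hp1 : 1 < p := by
    have := (ENNReal.HolderConjugate.lt_top_iff_one_lt q p).1 hq.lt_top
    exact this
  rw [Real.holderConjugate_iff]
  refine ⟨by simpa using (ENNReal.toReal_lt_toReal (by simp) hp).2 hp1, ?_⟩
  have h := ENNReal.HolderConjugate.inv_add_inv_eq_one p q
  have hp0 := ENNReal.HolderConjugate.ne_zero p q
  have hq0 := ENNReal.HolderConjugate.ne_zero q p
  rw [← ENNReal.toReal_inv, ← ENNReal.toReal_inv, ← ENNReal.toReal_add (by simpa) (by simpa), h]
  simp

/-- Hölder's inequality for nonnegative functions. -/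
theorem lintegral_mul_le_eLpNorm_mul_eLpNorm {p q : ℝ≥0∞} [hpq : ENNReal.HolderConjugate p q]
    {h k : α → ℝ≥0∞} (hh : AEMeasurable h μ) (hk : AEMeasurable k μ) :
    ∫⁻ x, h x * k x ∂μ ≤ eLpNorm h q μ * eLpNorm k p μ := by
  have hp0 := ENNReal.HolderConjugate.ne_zero p q
  have hq0 := ENNReal.HolderConjugate.ne_zero q p
  by_cases hq : q = ∞
  · have hp : p = 1 := (ENNReal.HolderConjugate.eq_top_iff_eq_one q p).1 hq
    subst hq hp
    rw [eLpNorm_ennreal_one, ← lintegral_const_mul'' _ hk]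
    exact lintegral_mono_ae ((ae_le_eLpNorm_top h).mono fun x hx => by gcongr)
  by_cases hp : p = ∞
  · have hq : q = 1 := (ENNReal.HolderConjugate.eq_top_iff_eq_one p q).1 hp
    subst hq hp
    rw [eLpNorm_ennreal_one, ← lintegral_mul_const'' _ hh]
    exact lintegral_mono_ae ((ae_le_eLpNorm_top k).mono fun x hx => by gcongr)
  rw [eLpNorm_ennreal_eq hp0 hp, eLpNorm_ennreal_eq hq0 hq]
  exact ENNReal.lintegral_mul_le_Lp_mul_Lq μ (toReal_holderConjugate (p := p) (q := q) hp hq).symm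
    hh hk

/-- The converse of Hölder's inequality on a `σ`-finite measure space. -/
theorem eLpNorm_le_of_forall_lintegral_mul_le [SigmaFinite μ] {p q : ℝ≥0∞}
    [hpq : ENNReal.HolderConjugate p q] {h : α → ℝ≥0∞} (hh : Measurable h) {c : ℝ≥0∞}
    (hc : ∀ k : α → ℝ≥0∞, Measurable k → eLpNorm k p μ ≤ 1 → ∫⁻ x, h x * k x ∂μ ≤ c) :
    eLpNorm h q μ ≤ c := by
  have hp0 := ENNReal.HolderConjugate.ne_zero p q
  have hq0 := ENNReal.HolderConjugate.ne_zero q p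
  by_cases hp : p = ∞
  · have hq : q = 1 := (ENNReal.HolderConjugate.eq_top_iff_eq_one p q).1 hp
    subst hq hp
    rw [eLpNorm_ennreal_one]
    simpa using hc (fun _ => 1) measurable_const (eLpNorm_top_le (by simp))
  by_cases hq : q = ∞
  · have hp : p = 1 := (ENNReal.HolderConjugate.eq_top_iff_eq_one q p).1 hq
    subst hq hp
    refine eLpNorm_top_le ?_
    by_contra hcon
    have hpos : 0 < μ {x | c < h x} := by
      rw [pos_iff_ne_zero]
      intro h0
      exact hcon (by rw [ae_iff]; simpa using h0)
    -- σ-finiteness gives a part of `{c < h}` of positive finite measure; its normalized indicator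
    -- is a test function that violates the bound.
    obtain ⟨s, hsm, hs, hs0, hsf⟩ := Measure.exists_subset_measure_lt_top
      (measurableSet_lt measurable_const hh) hpos
    have h1 := hc (s.indicator fun _ => (μ s)⁻¹) (measurable_const.indicator hsm) (by
      rw [eLpNorm_ennreal_one, lintegral_indicator_const hsm,
        ENNReal.inv_mul_cancel hs0.ne' hsf.ne])
    have hI : ∫⁻ x, h x * s.indicator (fun _ => (μ s)⁻¹) x ∂μ
        = (∫⁻ x in s, h x ∂μ) * (μ s)⁻¹ := by
      rw [← lintegral_mul_const _ hh, ← lintegral_indicator hsm]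
      congr 1
      ext x
      by_cases hx : x ∈ s <;> simp [hx]
    rw [hI] at h1
    have hcs : c < ∞ := by
      rcases eq_or_ne c ∞ with rfl | hne
      · simp at hpos
      · exact hne.lt_top
    have h2 : c * μ s < ∫⁻ x in s, h x ∂μ := by
      have := setLIntegral_strict_mono (μ := μ) (f := fun _ => c) hsm hs0.ne' hh
        (by simpa using (ENNReal.mul_lt_top hcs hsf).ne)
        (Filter.Eventually.of_forall fun x hx => hs hx)
      simpa using this
    have h3 : ∫⁻ x in s, h x ∂μ ≤ c * μ s := by
      rwa [← ENNReal.div_eq_inv_mul.trans (mul_comm _ _),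
        ENNReal.div_le_iff_le_mul (Or.inl hs0.ne') (Or.inl hsf.ne)] at h1
    exact absurd h2 h3.not_gt
  · have hP := toReal_holderConjugate (p := p) (q := q) hp hq
    have hq' : 0 < q.toReal := hP.symm.pos
    -- The norm of `h` may be infinite, so `h^q` is replaced by a simple minorant `g` whose integral
    -- `J` is finite and exceeds `b^q`. The extremal function of Hölder's inequality for `g` is `(g
    -- / J)^{1/p}`.
    refine le_of_forall_lt fun b hb => ?_
    rw [eLpNorm_ennreal_eq hq0 hq, one_div, ENNReal.lt_rpow_inv_iff hq'] at hb
    rw [lintegral_eq_nnreal] at hb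
    simp only [lt_iSup_iff] at hb
    obtain ⟨φ, hφ, hb⟩ := hb
    rw [← SimpleFunc.lintegral_eq_lintegral] at hb
    obtain ⟨g, hgφ, hgfin, hglt⟩ := exists_lt_lintegral_simpleFunc_of_lt_lintegral (f := φ) hb
    have hgle : ∀ x, (g x : ℝ≥0∞) ≤ h x ^ q.toReal := fun x =>
      (ENNReal.coe_le_coe.2 (hgφ x)).trans (hφ x)
    set J := ∫⁻ x, (g x : ℝ≥0∞) ∂μ with hJ
    have hgm : Measurable fun x => (g x : ℝ≥0∞) := g.measurable.coe_nnreal_ennreal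
    have hJ0 : J ≠ 0 := (zero_le.trans_lt hglt).ne'
    have h1 := hc (fun x => (g x : ℝ≥0∞) ^ (1 / p.toReal) * J ^ (-(1 / p.toReal)))
      ((hgm.pow_const _).mul_const _) (by
        rw [eLpNorm_ennreal_eq hp0 hp]
        have : ∀ x, ((g x : ℝ≥0∞) ^ (1 / p.toReal) * J ^ (-(1 / p.toReal))) ^ p.toReal
            = g x * J⁻¹ := by
          intro x
          rw [ENNReal.mul_rpow_of_nonneg _ _ hP.pos.le, ← ENNReal.rpow_mul, ← ENNReal.rpow_mul,
            one_div_mul_cancel hP.pos.ne', neg_mul, one_div_mul_cancel hP.pos.ne',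
            ENNReal.rpow_one, ENNReal.rpow_neg_one]
        simp_rw [this]
        rw [lintegral_mul_const _ hgm, ENNReal.mul_inv_cancel hJ0 hgfin.ne, ENNReal.one_rpow])
    refine lt_of_lt_of_le ?_ h1
    have h2 : J ^ (1 / q.toReal) ≤
        ∫⁻ x, h x * ((g x : ℝ≥0∞) ^ (1 / p.toReal) * J ^ (-(1 / p.toReal))) ∂μ := by
      calc J ^ (1 / q.toReal) = J * J ^ (-(1 / p.toReal)) := by
            nth_rewrite 2 [← ENNReal.rpow_one J]
            rw [← ENNReal.rpow_add _ _ hJ0 hgfin.ne]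
            congr 1
            have := hP.inv_add_inv_eq_one
            simp only [one_div]
            linarith
        _ = ∫⁻ x, (g x : ℝ≥0∞) * J ^ (-(1 / p.toReal)) ∂μ := by
            rw [lintegral_mul_const _ hgm]
        _ ≤ _ := by
            refine lintegral_mono fun x => ?_
            rw [← mul_assoc]
            gcongr
            have h3 : (g x : ℝ≥0∞) ^ (1 / q.toReal) ≤ h x := by
              rw [one_div, ENNReal.rpow_inv_le_iff hq']
              exact hgle x
            calc (g x : ℝ≥0∞) = (g x : ℝ≥0∞) ^ (1 / q.toReal) * (g x : ℝ≥0∞) ^ (1 / p.toReal) := by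
                  rw [← ENNReal.rpow_add_of_nonneg _ _ (by positivity) (by positivity)]
                  have := hP.inv_add_inv_eq_one
                  rw [show 1 / q.toReal + 1 / p.toReal = 1 by simp only [one_div]; linarith,
                    ENNReal.rpow_one]
              _ ≤ _ := by gcongr
    refine lt_of_lt_of_le ?_ h2
    rwa [one_div, ENNReal.lt_rpow_inv_iff hq']

/-- Minkowski's inequality for countable sums of nonnegative functions. -/
theorem eLpNorm_tsum_le [SigmaFinite μ] {ι : Type*} [Countable ι] {p : ℝ≥0∞} (hp : 1 ≤ p)
    {f : ι → α → ℝ≥0∞} (hf : ∀ i, Measurable (f i)) :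
    eLpNorm (fun x => ∑' i, f i x) p μ ≤ ∑' i, eLpNorm (f i) p μ := by
  have : ENNReal.HolderConjugate p p.conjExponent :=
    ENNReal.HolderConjugate.conjExponent hp
  refine eLpNorm_le_of_forall_lintegral_mul_le (p := p.conjExponent) (q := p)
    (Measurable.tsum hf) fun k hk hk1 => ?_
  simp_rw [← ENNReal.tsum_mul_right]
  rw [lintegral_tsum (f := fun i x => f i x * k x) fun i => ((hf i).mul hk).aemeasurable]
  refine ENNReal.tsum_le_tsum fun i => ?_
  calc _ ≤ eLpNorm (f i) p μ * eLpNorm k p.conjExponent μ :=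
        lintegral_mul_le_eLpNorm_mul_eLpNorm (hf i).aemeasurable hk.aemeasurable
    _ ≤ _ := mul_le_of_le_one_right' hk1

theorem eLpNorm_count_eq_tsum {p : ℝ≥0∞} (hp0 : p ≠ 0) (hp : p ≠ ∞) (a : ℤ → ℝ≥0∞) :
    eLpNorm a p Measure.count = (∑' i, a i ^ p.toReal) ^ (1 / p.toReal) := by
  rw [eLpNorm_ennreal_eq hp0 hp, lintegral_count]

theorem le_eLpNorm_count {p : ℝ≥0∞} (hp0 : p ≠ 0) (a : ℤ → ℝ≥0∞) (i : ℤ) :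
    a i ≤ eLpNorm a p Measure.count := by
  by_cases hp : p = ∞
  · subst hp
    rw [eLpNorm_ennreal_top, essSup_count]
    exact le_iSup a i
  · rw [eLpNorm_count_eq_tsum hp0 hp, one_div, ENNReal.le_rpow_inv_iff (ENNReal.toReal_pos hp0 hp)]
    exact ENNReal.le_tsum i

theorem eLpNorm_restrict_iUnion {p : ℝ≥0∞} (hp0 : p ≠ 0) {A : ℤ → Set α}
    (hA : ∀ i, MeasurableSet (A i)) (hd : Pairwise (Function.onFun Disjoint A)) (g : α → ℝ≥0∞) :
    eLpNorm g p (μ.restrict (⋃ i, A i))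
      = eLpNorm (fun i => eLpNorm g p (μ.restrict (A i))) p Measure.count := by
  by_cases hp : p = ∞
  · subst hp
    apply le_antisymm
    · refine eLpNorm_top_le ?_
      rw [ae_restrict_iUnion_iff]
      intro i
      filter_upwards [ae_le_eLpNorm_top (μ := μ.restrict (A i)) g] with x hx
      exact hx.trans (le_eLpNorm_count (by simp) (fun i => eLpNorm g ∞ (μ.restrict (A i))) i)
    · refine eLpNorm_top_le (Filter.Eventually.of_forall fun i => ?_)
      exact eLpNorm_restrict_mono g (subset_iUnion A i)
  · rw [eLpNorm_count_eq_tsum hp0 hp, eLpNorm_ennreal_eq hp0 hp, lintegral_iUnion hA hd]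
    simp_rw [eLpNorm_ennreal_rpow hp0 hp]

/-- For finite `p` this is continuity from below of the measure with density `g^p`, valid for
arbitrary sets `E i`. -/
theorem eLpNorm_restrict_iUnion_le_of_directed [SFinite μ] {ι : Type*} [Countable ι] {p : ℝ≥0∞}
    {E : ι → Set α} (hE : Directed (· ⊆ ·) E) (g : α → ℝ≥0∞) {c : ℝ≥0∞}
    (hc : ∀ i, eLpNorm g p (μ.restrict (E i)) ≤ c) :
    eLpNorm g p (μ.restrict (⋃ i, E i)) ≤ c := by
  by_cases hp0 : p = 0
  · simp [hp0]
  by_cases hp : p = ∞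
  · subst hp
    refine eLpNorm_top_le ?_
    rw [ae_restrict_iUnion_iff]
    intro i
    filter_upwards [ae_le_eLpNorm_top (μ := μ.restrict (E i)) g] with x hx
    exact hx.trans (hc i)
  · have hp' := ENNReal.toReal_pos hp0 hp
    simp only [eLpNorm_ennreal_eq hp0 hp, one_div, ENNReal.rpow_inv_le_iff hp'] at hc ⊢
    simp only [← withDensity_apply'] at hc ⊢
    rw [hE.measure_iUnion]
    exact iSup_le hc

/-- Norms over `{ρ ∈ I}` are controlled by norms over the sets `{s ≤ ρ}` with `s ∈ I`. -/
theorem eLpNorm_restrict_preimage_le_of_forall_le [SFinite μ] {p : ℝ≥0∞} {ρ : α → ℝ} {I : Set ℝ}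
    (g : α → ℝ≥0∞) {c : ℝ≥0∞} (hc : ∀ s ∈ I, eLpNorm g p (μ.restrict {x | s ≤ ρ x}) ≤ c) :
    eLpNorm g p (μ.restrict (ρ ⁻¹' I)) ≤ c := by
  by_cases hm : ∃ s ∈ I, ∀ t ∈ I, s ≤ t
  · obtain ⟨s, hs, hst⟩ := hm
    exact (eLpNorm_restrict_mono g fun x hx => hst _ hx).trans (hc s hs)
  push Not at hm
  let ι := {q : ℚ // ∃ s ∈ I, s ≤ (q : ℝ)}
  let E : ι → Set α := fun q => {x | (q.1 : ℝ) ≤ ρ x}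
  have hE : Directed (· ⊆ ·) E := by
    intro a b
    rcases le_total a.1 b.1 with hab | hab
    · refine ⟨a, le_rfl, fun x hx => ?_⟩
      have : (a.1 : ℝ) ≤ b.1 := by exact_mod_cast hab
      exact this.trans hx
    · refine ⟨b, fun x hx => ?_, le_rfl⟩
      have : (b.1 : ℝ) ≤ a.1 := by exact_mod_cast hab
      exact this.trans hx
  refine (eLpNorm_restrict_mono g ?_).trans
    (eLpNorm_restrict_iUnion_le_of_directed (μ := μ) hE g (c := c) ?_)
  · intro x hx
    obtain ⟨t, ht, htx⟩ := hm _ hx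
    obtain ⟨q, hq1, hq2⟩ := exists_rat_btwn htx
    exact mem_iUnion.2 ⟨⟨q, t, ht, hq1.le⟩, hq2.le⟩
  · rintro ⟨q, s, hs, hsq⟩
    exact (eLpNorm_restrict_mono g fun x hx => hsq.trans hx).trans (hc s hs)

/-- Norms over `{ρ ∈ D}` are controlled by norms over the sets `{ρ < s}` with `s ∈ D`, provided
that the level sets of `ρ` are null. -/
theorem eLpNorm_restrict_preimage_le_of_forall_lt [SFinite μ] {p : ℝ≥0∞} {ρ : α → ℝ}
    (hρ : ∀ s, μ {x | ρ x = s} = 0) {D : Set ℝ} (g : α → ℝ≥0∞) {c : ℝ≥0∞}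
    (hc : ∀ s ∈ D, eLpNorm g p (μ.restrict {x | ρ x < s}) ≤ c) :
    eLpNorm g p (μ.restrict (ρ ⁻¹' D)) ≤ c := by
  let ι := {q : ℚ // ∃ s ∈ D, (q : ℝ) ≤ s}
  let E : ι → Set α := fun q => {x | ρ x < (q.1 : ℝ)}
  have hE : Directed (· ⊆ ·) E := by
    intro a b
    rcases le_total a.1 b.1 with hab | hab
    · refine ⟨b, fun x hx => ?_, le_rfl⟩
      have : (a.1 : ℝ) ≤ b.1 := by exact_mod_cast hab
      exact lt_of_lt_of_le hx this
    · refine ⟨a, le_rfl, fun x hx => ?_⟩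
      have : (b.1 : ℝ) ≤ a.1 := by exact_mod_cast hab
      exact lt_of_lt_of_le hx this
  refine (eLpNorm_restrict_mono_ae g ?_).trans
    (eLpNorm_restrict_iUnion_le_of_directed (μ := μ) hE g (c := c) ?_)
  -- The sets `{ρ < s}` with `s ∈ D` miss only points where `ρ` equals the maximum of `D`, which
  -- form a null level set.
  · have hnull : ∀ᵐ x ∂μ, ¬ (ρ x ∈ D ∧ ∀ t ∈ D, t ≤ ρ x) := by
      by_cases hm : ∃ s ∈ D, ∀ t ∈ D, t ≤ s
      · obtain ⟨s, hs, hst⟩ := hm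
        have : ∀ᵐ x ∂μ, ρ x ≠ s := by rw [ae_iff]; simpa using hρ s
        filter_upwards [this] with x hx ⟨h1, h2⟩
        exact hx (le_antisymm (hst _ h1) (h2 s hs))
      · exact Filter.Eventually.of_forall fun x hx => hm ⟨_, hx⟩
    filter_upwards [hnull] with x hx hxD
    have hxD' : ρ x ∈ D := hxD
    push Not at hx
    obtain ⟨t, ht, htx⟩ := hx hxD'
    obtain ⟨q, hq1, hq2⟩ := exists_rat_btwn htx
    exact mem_iUnion.2 ⟨⟨q, t, ht, hq2.le⟩, hq1⟩
  · rintro ⟨q, s, hs, hsq⟩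
    exact (eLpNorm_restrict_mono g fun x hx => lt_of_lt_of_le hx hsq).trans (hc s hs)

end LpBasics

/-! ### Homogeneity of the norms and the embedding of `ℓ^θ` into `ℓ^1`. -/

section LpScaling

variable {α : Type*} [MeasurableSpace α] {μ : Measure α}

theorem eLpNorm_ennreal_mul_const {p : ℝ≥0∞} (hp0 : p ≠ 0) {g : α → ℝ≥0∞}
    (hg : AEMeasurable g μ) (c : ℝ≥0∞) :
    eLpNorm (fun x => g x * c) p μ = eLpNorm g p μ * c := by
  by_cases hp : p = ∞
  · subst hp
    simp_rw [eLpNorm_ennreal_top, mul_comm _ c]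
    exact ENNReal.essSup_const_mul
  · have hp' := ENNReal.toReal_pos hp0 hp
    simp_rw [eLpNorm_ennreal_eq hp0 hp, ENNReal.mul_rpow_of_nonneg _ _ hp'.le]
    rw [lintegral_mul_const'' _ (hg.pow_const _), ENNReal.mul_rpow_of_nonneg _ _ (by positivity),
      ← ENNReal.rpow_mul, mul_one_div_cancel hp'.ne', ENNReal.rpow_one]

/-- The `ℓ¹` norm is at most the `ℓ^θ` quasi-norm for `θ ≤ 1`. -/
theorem tsum_le_eLpNorm_count {θ : ℝ≥0∞} (hθ0 : θ ≠ 0) (hθ : θ ≤ 1) (a : ℤ → ℝ≥0∞) :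
    ∑' i, a i ≤ eLpNorm a θ Measure.count := by
  have hθt : θ ≠ ∞ := (hθ.trans_lt ENNReal.one_lt_top).ne
  have hθ' := ENNReal.toReal_pos hθ0 hθt
  have hθ1 : θ.toReal ≤ 1 := by simpa using ENNReal.toReal_mono ENNReal.one_ne_top hθ
  rw [eLpNorm_count_eq_tsum hθ0 hθt, one_div, ENNReal.le_rpow_inv_iff hθ']
  rw [← ENNReal.le_rpow_inv_iff hθ']
  refine ENNReal.summable.tsum_le_of_sum_le fun s => ?_
  rw [ENNReal.le_rpow_inv_iff hθ']
  refine le_trans ?_ (ENNReal.sum_le_tsum s)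
  induction s using Finset.induction_on with
  | empty => simp [ENNReal.zero_rpow_of_pos hθ']
  | insert i s hi ih =>
    rw [Finset.sum_insert hi, Finset.sum_insert hi]
    exact (ENNReal.rpow_add_le_add_rpow _ _ hθ'.le hθ1).trans (by gcongr)

end LpScaling

/-! ### Dyadic level shells of a monotone function. -/

theorem zpow_two_pos (j : ℤ) : (0 : ℝ≥0∞) < 2 ^ j := ENNReal.zpow_pos (by simp) (by simp) j

theorem zpow_two_ne_top (j : ℤ) : (2 : ℝ≥0∞) ^ j ≠ ∞ :=
  (ENNReal.zpow_lt_top (by simp) (by simp) j).ne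

theorem zpow_two_add (i j : ℤ) : (2 : ℝ≥0∞) ^ (i + j) = 2 ^ i * 2 ^ j :=
  ENNReal.zpow_add (by simp) (by simp) i j

/-- The set where `W` lies in the dyadic interval `(2 ^ j, 2 ^ (j + 1)]`. -/
def dyadicShell (W : ℝ → ℝ≥0∞) (j : ℤ) : Set ℝ := {r | 2 ^ j < W r ∧ W r ≤ 2 ^ (j + 1)}

theorem measurableSet_dyadicShell {W : ℝ → ℝ≥0∞} (hW : Monotone W) (j : ℤ) :
    MeasurableSet (dyadicShell W j) :=
  (measurableSet_lt measurable_const hW.measurable).inter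
    (measurableSet_le hW.measurable measurable_const)

theorem pairwise_disjoint_dyadicShell (W : ℝ → ℝ≥0∞) :
    Pairwise (Function.onFun Disjoint (dyadicShell W)) := by
  have key : ∀ i j : ℤ, i < j → Disjoint (dyadicShell W i) (dyadicShell W j) := by
    intro i j hij
    rw [Set.disjoint_left]
    rintro r ⟨_, h1⟩ ⟨h2, _⟩
    have : (2 : ℝ≥0∞) ^ (i + 1) ≤ 2 ^ j := ENNReal.zpow_le_of_le (by simp) (by lia)
    exact absurd (h2.trans_le (h1.trans this)) (lt_irrefl _)
  intro i j hij
  rcases lt_or_gt_of_ne hij with h | h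
  · exact key i j h
  · exact (key j i h).symm

theorem exists_mem_dyadicShell {W : ℝ → ℝ≥0∞} {r : ℝ} (h0 : 0 < W r) (h1 : W r < ∞) :
    ∃ j, r ∈ dyadicShell W j :=
  ENNReal.exists_mem_Ioc_zpow h0.ne' h1.ne (by simp) (by simp)

/-! ### The function `t ↦ ‖ω‖_{θ,(0,t)}` and its level sets. -/

section Head

variable {θ : ℝ≥0∞} {ω : ℝ → ℝ≥0∞}

theorem wNorm_one_eq_eLpNorm {β : Type*} [MeasureSpace β] (hθ : θ ≠ 0) (A : Set β)
    (g : β → ℝ≥0∞) : wNorm θ A 1 g = eLpNorm g θ (volume.restrict A) := by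
  unfold wNorm
  split_ifs with h
  · subst h
    rw [eLpNorm_ennreal_top]
    simp
  · simp [eLpNorm_ennreal_eq hθ h]

theorem headNorm_eq_eLpNorm (hθ : θ ≠ 0) (t : ℝ) :
    headNorm θ ω t = eLpNorm ω θ (volume.restrict (Ioo 0 t)) :=
  wNorm_one_eq_eLpNorm hθ _ _

theorem headNorm_of_nonpos (hθ : θ ≠ 0) {t : ℝ} (ht : t ≤ 0) : headNorm θ ω t = 0 := by
  rw [headNorm_eq_eLpNorm hθ, Ioo_eq_empty (by simpa using ht)]
  simp

theorem pos_of_headNorm_pos (hθ : θ ≠ 0) {t : ℝ} (ht : 0 < headNorm θ ω t) : 0 < t := by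
  by_contra h
  exact ht.ne' (headNorm_of_nonpos hθ (not_lt.1 h))

theorem pos_of_mem_dyadicShell (hθ : θ ≠ 0) {j : ℤ} {t : ℝ}
    (ht : t ∈ dyadicShell (headNorm θ ω) j) : 0 < t :=
  pos_of_headNorm_pos hθ (zero_le.trans_lt ht.1)

theorem iUnion_dyadicShell_headNorm (hθ : θ ≠ 0) (hω : OmegaCompl θ ω) :
    ⋃ j, dyadicShell (headNorm θ ω) j = Ioi 0 := by
  ext t
  rw [mem_iUnion]
  exact ⟨fun ⟨j, hj⟩ => pos_of_mem_dyadicShell hθ hj,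
    fun ht => exists_mem_dyadicShell (hω.2 t ht).1 (hω.2 t ht).2⟩

/-- Up to a possible right endpoint, the sublevel set is a union of intervals `(0,s)` on each of
which the norm of `ω` is at most `c`. This is the left continuity of `W`; it lets jumps of `W`
(possible for `θ = ∞`) be ignored. -/
theorem eLpNorm_sublevel_headNorm_le (hθ : θ ≠ 0) (c : ℝ≥0∞) :
    eLpNorm ω θ (volume.restrict (Ioi 0 ∩ {r | headNorm θ ω r ≤ c})) ≤ c := by
  have h := eLpNorm_restrict_preimage_le_of_forall_lt (μ := volume.restrict (Ioi (0 : ℝ)))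
    (ρ := fun r : ℝ => r) (D := {r | headNorm θ ω r ≤ c}) (p := θ) (c := c) (fun s => by simp) ω
    (fun s hs => by
      rw [Measure.restrict_restrict (by exact measurableSet_Iio)]
      have : {x : ℝ | x < s} ∩ Ioi 0 = Ioo 0 s := by ext; simp [and_comm]
      rw [this, ← headNorm_eq_eLpNorm hθ]
      exact hs)
  rw [preimage_id', Measure.restrict_restrict
    (measurableSet_le (headNorm_mono θ ω).measurable measurable_const), inter_comm] at h
  exact h

end Head

/-! ### Discretization of the Morrey-type norm over the shells. -/

section Shells

variable {α : Type*} [MeasurableSpace α] {μ : Measure α}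

/-- The norm of `k` over `{r ≤ ρ}`, as a function of `r`. -/
noncomputable def tailNorm (μ : Measure α) (ρ : α → ℝ) (p : ℝ≥0∞) (k : α → ℝ≥0∞) (r : ℝ) : ℝ≥0∞ :=
  eLpNorm k p (μ.restrict {x | r ≤ ρ x})

theorem tailNorm_antitone (ρ : α → ℝ) (p : ℝ≥0∞) (k : α → ℝ≥0∞) :
    Antitone (tailNorm μ ρ p k) := fun _ _ hrs =>
  eLpNorm_restrict_mono k fun _ hx => hrs.trans hx

/-- `∫_{2^j<W≤2^{j+1}} (ω N)^θ` dominates `(2^j N(s))^θ` for a non-increasing `N`. -/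
theorem rpow_mul_le_add_of_mem_dyadicShell {θ : ℝ≥0∞} {ω : ℝ → ℝ≥0∞} (hθ0 : θ ≠ 0) (hθ : θ ≠ ∞)
    (hω : OmegaCompl θ ω) {N : ℝ → ℝ≥0∞} (hN : Antitone N) {j : ℤ} {s : ℝ}
    (hs : s ∈ dyadicShell (headNorm θ ω) j) :
    (1 - 2 ^ (-θ.toReal)) * (2 ^ j * N s) ^ θ.toReal ≤
      eLpNorm (fun r => ω r * N r) θ
          (volume.restrict (dyadicShell (headNorm θ ω) (j - 1))) ^ θ.toReal +
        eLpNorm (fun r => ω r * N r) θ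
          (volume.restrict (dyadicShell (headNorm θ ω) j)) ^ θ.toReal := by
  have hθ' := ENNReal.toReal_pos hθ0 hθ
  set W := headNorm θ ω with hW
  have hWm : Measurable W := (headNorm_mono θ ω).measurable
  set D := Ioi 0 ∩ {r | W r ≤ 2 ^ (j - 1)} with hD
  have hDm : MeasurableSet D :=
    measurableSet_Ioi.inter (measurableSet_le hWm measurable_const)
  set S := dyadicShell W (j - 1) ∪ dyadicShell W j with hS
  -- Shell `j` alone is not enough: `s` may lie at its very beginning. Shell `j - 1` is added, and
  -- only the mass below level `2^(j-1)` is discarded.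
  have hcover : Ioo 0 s ⊆ D ∪ (S ∩ Iio s) := by
    intro r hr
    by_cases h : W r ≤ 2 ^ (j - 1)
    · exact Or.inl ⟨hr.1, h⟩
    · refine Or.inr ⟨?_, hr.2⟩
      by_cases h2 : W r ≤ 2 ^ j
      · exact Or.inl ⟨not_le.1 h, by simpa using h2⟩
      · exact Or.inr ⟨not_le.1 h2, (headNorm_mono θ ω hr.2.le).trans hs.2⟩
  have h1 : ((2 : ℝ≥0∞) ^ j) ^ θ.toReal ≤ ((2 : ℝ≥0∞) ^ (j - 1)) ^ θ.toReal +
      ∫⁻ r in S ∩ Iio s, ω r ^ θ.toReal := by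
    calc ((2 : ℝ≥0∞) ^ j) ^ θ.toReal ≤ W s ^ θ.toReal := by gcongr; exact hs.1.le
      _ = ∫⁻ r in Ioo 0 s, ω r ^ θ.toReal := by
          rw [hW, headNorm_eq_eLpNorm hθ0, eLpNorm_ennreal_rpow hθ0 hθ]
      _ ≤ ∫⁻ r in D ∪ (S ∩ Iio s), ω r ^ θ.toReal := lintegral_mono_set hcover
      _ ≤ (∫⁻ r in D, ω r ^ θ.toReal) + ∫⁻ r in S ∩ Iio s, ω r ^ θ.toReal :=
          lintegral_union_le _ _ _
      _ ≤ _ := by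
          gcongr
          rw [← eLpNorm_ennreal_rpow hθ0 hθ]
          gcongr
          exact eLpNorm_sublevel_headNorm_le hθ0 _
  have h2 : ((2 : ℝ≥0∞) ^ (j - 1)) ^ θ.toReal = 2 ^ (-θ.toReal) * ((2 : ℝ≥0∞) ^ j) ^ θ.toReal := by
    rw [sub_eq_add_neg, zpow_two_add, ENNReal.mul_rpow_of_nonneg _ _ hθ'.le, mul_comm,
      ENNReal.rpow_neg, ENNReal.zpow_neg, zpow_one, ENNReal.inv_rpow]
  have h3 : (1 - (2 : ℝ≥0∞) ^ (-θ.toReal)) * ((2 : ℝ≥0∞) ^ j) ^ θ.toReal ≤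
      ∫⁻ r in S ∩ Iio s, ω r ^ θ.toReal := by
    rw [ENNReal.sub_mul (by
      intros
      exact ENNReal.rpow_ne_top_of_nonneg hθ'.le (zpow_two_ne_top j)), one_mul,
      tsub_le_iff_left, ← h2]
    exact h1
  have hωm : AEMeasurable ω (volume.restrict (S ∩ Iio s)) := by
    refine hω.1.mono_measure (Measure.restrict_mono ?_ le_rfl)
    rintro r ⟨hr | hr, _⟩
    · exact pos_of_mem_dyadicShell hθ0 hr
    · exact pos_of_mem_dyadicShell hθ0 hr
  calc (1 - 2 ^ (-θ.toReal)) * (2 ^ j * N s) ^ θ.toReal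
      = (1 - (2 : ℝ≥0∞) ^ (-θ.toReal)) * ((2 : ℝ≥0∞) ^ j) ^ θ.toReal * N s ^ θ.toReal := by
        rw [ENNReal.mul_rpow_of_nonneg _ _ hθ'.le, mul_assoc]
    _ ≤ (∫⁻ r in S ∩ Iio s, ω r ^ θ.toReal) * N s ^ θ.toReal := by gcongr
    _ = ∫⁻ r in S ∩ Iio s, ω r ^ θ.toReal * N s ^ θ.toReal := by
        rw [lintegral_mul_const'' _ (hωm.pow_const _)]
    _ ≤ ∫⁻ r in S ∩ Iio s, (ω r * N r) ^ θ.toReal := by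
        refine setLIntegral_mono' (((measurableSet_dyadicShell (headNorm_mono θ ω) _).union
          (measurableSet_dyadicShell (headNorm_mono θ ω) _)).inter measurableSet_Iio)
          fun r hr => ?_
        rw [ENNReal.mul_rpow_of_nonneg _ _ hθ'.le]
        gcongr
        exact hN (le_of_lt hr.2)
    _ ≤ ∫⁻ r in S, (ω r * N r) ^ θ.toReal := lintegral_mono_set inter_subset_left
    _ ≤ _ := by
        rw [eLpNorm_ennreal_rpow hθ0 hθ, eLpNorm_ennreal_rpow hθ0 hθ]
        exact lintegral_union_le _ _ _

/-- Dyadic discretization of the norm `‖ω(r) ‖k‖_{p,{r ≤ ρ}}‖_θ`. -/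
theorem exists_eLpNorm_shells_le {θ : ℝ≥0∞} {ω : ℝ → ℝ≥0∞} (hθ0 : θ ≠ 0)
    (hω : OmegaCompl θ ω) (μ : Measure α) [SigmaFinite μ] (ρ : α → ℝ) (p : ℝ≥0∞) :
    ∃ C : ℝ≥0, ∀ k : α → ℝ≥0∞,
      eLpNorm (fun j : ℤ => 2 ^ j *
          eLpNorm k p (μ.restrict (ρ ⁻¹' dyadicShell (headNorm θ ω) j))) θ Measure.count ≤
        C * eLpNorm (fun r => ω r * tailNorm μ ρ p k r) θ (volume.restrict (Ioi 0)) := by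
  set W := headNorm θ ω with hW
  by_cases hθ : θ = ∞
  -- For `θ = ∞` no mass has to be subtracted: `W(s) N(s)` is already at most the supremum, by
  -- monotonicity of the tail norm `N`.
  · subst hθ
    refine ⟨1, fun k => ?_⟩
    set M := eLpNorm (fun r => ω r * tailNorm μ ρ p k r) ∞ (volume.restrict (Ioi 0)) with hM
    rw [ENNReal.coe_one, one_mul]
    refine eLpNorm_top_le (Filter.Eventually.of_forall fun j => ?_)
    rw [mul_comm, ← ENNReal.le_div_iff_mul_le (Or.inl (zpow_two_pos j).ne')
      (Or.inl (zpow_two_ne_top j))]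
    refine eLpNorm_restrict_preimage_le_of_forall_le k fun s hs => ?_
    rw [ENNReal.le_div_iff_mul_le (Or.inl (zpow_two_pos j).ne')
      (Or.inl (zpow_two_ne_top j)), mul_comm]
    have hsub : Ioo 0 s ⊆ Ioi 0 := fun r hr => hr.1
    calc _ ≤ W s * tailNorm μ ρ p k s := by
          gcongr
          · exact hs.1.le
          · exact le_rfl
      _ = eLpNorm (fun r => ω r * tailNorm μ ρ p k s) ∞ (volume.restrict (Ioo 0 s)) := by
          rw [eLpNorm_ennreal_mul_const hθ0
            (hω.1.mono_measure (Measure.restrict_mono hsub le_rfl)), hW, headNorm_eq_eLpNorm hθ0]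
      _ ≤ eLpNorm (fun r => ω r * tailNorm μ ρ p k r) ∞ (volume.restrict (Ioo 0 s)) := by
          refine eLpNorm_ennreal_mono ?_
          filter_upwards [ae_restrict_mem measurableSet_Ioo] with r hr
          gcongr
          exact tailNorm_antitone ρ p k hr.2.le
      _ ≤ M := eLpNorm_restrict_mono _ hsub
  · have hθ' := ENNReal.toReal_pos hθ0 hθ
    set c : ℝ≥0∞ := 1 - 2 ^ (-θ.toReal) with hc
    have hc0 : c ≠ 0 := by
      rw [hc, Ne, tsub_eq_zero_iff_le, not_le]
      exact ENNReal.rpow_lt_one_of_one_lt_of_neg (by simp) (by linarith)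
    have hct : c ≠ ∞ := (tsub_le_self.trans_lt ENNReal.one_lt_top).ne
    have hCt : (c⁻¹ * 2) ^ (1 / θ.toReal) ≠ ∞ :=
      ENNReal.rpow_ne_top_of_nonneg (by positivity)
        (ENNReal.mul_ne_top (ENNReal.inv_ne_top.2 hc0) (by simp))
    refine ⟨((c⁻¹ * 2) ^ (1 / θ.toReal)).toNNReal, fun k => ?_⟩
    rw [ENNReal.coe_toNNReal hCt]
    set a : ℤ → ℝ≥0∞ := fun j => eLpNorm (fun r => ω r * tailNorm μ ρ p k r) θ
      (volume.restrict (dyadicShell W j)) with ha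
    -- The bound for single points `s` of the shell passes to the whole shell by exhaustion with the
    -- sets `{s ≤ ρ}`.
    have key : ∀ j : ℤ, (2 ^ j * eLpNorm k p (μ.restrict (ρ ⁻¹' dyadicShell W j))) ^ θ.toReal ≤
        c⁻¹ * (a (j - 1) ^ θ.toReal + a j ^ θ.toReal) := by
      intro j
      rw [← ENNReal.le_rpow_inv_iff hθ', mul_comm,
        ← ENNReal.le_div_iff_mul_le (Or.inl (zpow_two_pos j).ne') (Or.inl (zpow_two_ne_top j))]
      refine eLpNorm_restrict_preimage_le_of_forall_le k fun s hs => ?_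
      rw [ENNReal.le_div_iff_mul_le (Or.inl (zpow_two_pos j).ne')
        (Or.inl (zpow_two_ne_top j)), mul_comm, ENNReal.le_rpow_inv_iff hθ',
        ← ENNReal.div_eq_inv_mul, ENNReal.le_div_iff_mul_le (Or.inl hc0) (Or.inl hct), mul_comm]
      exact rpow_mul_le_add_of_mem_dyadicShell hθ0 hθ hω (tailNorm_antitone ρ p k) hs
    have hglue := eLpNorm_restrict_iUnion (μ := volume) hθ0
      (measurableSet_dyadicShell (headNorm_mono θ ω)) (pairwise_disjoint_dyadicShell W)
      (fun r => ω r * tailNorm μ ρ p k r)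
    rw [iUnion_dyadicShell_headNorm hθ0 hω] at hglue
    rw [hglue, eLpNorm_count_eq_tsum hθ0 hθ, eLpNorm_count_eq_tsum hθ0 hθ,
      ← ENNReal.mul_rpow_of_nonneg _ _ (by positivity)]
    gcongr
    calc _ ≤ ∑' j, c⁻¹ * (a (j - 1) ^ θ.toReal + a j ^ θ.toReal) := ENNReal.tsum_le_tsum key
      _ = c⁻¹ * 2 * ∑' j, a j ^ θ.toReal := by
          have hshift : ∑' j, a (j - 1) ^ θ.toReal = ∑' j, a j ^ θ.toReal :=
            (Equiv.subRight (1 : ℤ)).tsum_eq (fun j => a j ^ θ.toReal)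
          rw [ENNReal.tsum_mul_left, ENNReal.tsum_add, hshift, ← two_mul, mul_assoc]

/-- Hölder's inequality on dyadic shells. -/
theorem lintegral_mul_le_tsum_shells {W : ℝ → ℝ≥0∞} (hW : Monotone W)
    {ρ : α → ℝ} (hρ : Measurable ρ) (hWρ : ∀ᵐ x ∂μ, 0 < W (ρ x) ∧ W (ρ x) < ∞) {p q : ℝ≥0∞}
    [ENNReal.HolderConjugate p q] {h k : α → ℝ≥0∞} (hh : AEMeasurable h μ)
    (hk : AEMeasurable k μ) :
    ∫⁻ x, h x * k x ∂μ ≤ ∑' j, eLpNorm h q (μ.restrict (ρ ⁻¹' dyadicShell W j)) *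
      eLpNorm k p (μ.restrict (ρ ⁻¹' dyadicShell W j)) := by
  have hU : ∀ᵐ x ∂μ, x ∈ ⋃ j, ρ ⁻¹' dyadicShell W j := by
    filter_upwards [hWρ] with x hx
    obtain ⟨j, hj⟩ := exists_mem_dyadicShell (W := W) (r := ρ x) hx.1 hx.2
    exact mem_iUnion.2 ⟨j, hj⟩
  rw [← Measure.restrict_eq_self_of_ae_mem hU, lintegral_iUnion
    (fun j => hρ (measurableSet_dyadicShell hW j))
    (fun i j hij => (pairwise_disjoint_dyadicShell W hij).preimage ρ)]
  refine ENNReal.tsum_le_tsum fun j => ?_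
  rw [Measure.restrict_eq_self_of_ae_mem hU]
  exact lintegral_mul_le_eLpNorm_mul_eLpNorm hh.restrict hk.restrict

end Shells

theorem eLpNorm_count_comp_equiv {p : ℝ≥0∞} (e : ℤ ≃ ℤ) (a : ℤ → ℝ≥0∞) :
    eLpNorm (fun i => a (e i)) p Measure.count = eLpNorm a p Measure.count := by
  by_cases hp0 : p = 0
  · simp [hp0]
  by_cases hp : p = ∞
  · subst hp
    rw [eLpNorm_ennreal_top, eLpNorm_ennreal_top, essSup_count, essSup_count]
    exact e.iSup_comp (g := a)
  · rw [eLpNorm_count_eq_tsum hp0 hp, eLpNorm_count_eq_tsum hp0 hp,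
      e.tsum_eq (fun i => a i ^ p.toReal)]

/-! ### Upper and lower bounds for the pairing with the unit ball. -/

section Duality

variable {α : Type*} [MeasurableSpace α] {μ : Measure α} [SigmaFinite μ] {ρ : α → ℝ}
  {p q θ : ℝ≥0∞} {ω : ℝ → ℝ≥0∞}

/-- The norm of `h` over `{W ∘ ρ ≤ 2 ^ j}`. -/
noncomputable def sublevelNorm (μ : Measure α) (ρ : α → ℝ) (W : ℝ → ℝ≥0∞) (q : ℝ≥0∞)
    (h : α → ℝ≥0∞) (j : ℤ) : ℝ≥0∞ :=
  eLpNorm h q (μ.restrict {x | W (ρ x) ≤ 2 ^ j})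

omit [SigmaFinite μ] in
theorem ae_headNorm_pos_lt_top (hω : OmegaCompl θ ω) (hρ0 : ∀ᵐ x ∂μ, 0 < ρ x) :
    ∀ᵐ x ∂μ, 0 < headNorm θ ω (ρ x) ∧ headNorm θ ω (ρ x) < ∞ :=
  hρ0.mono fun _ hx => hω.2 _ hx

theorem exists_lintegral_mul_le_iSup [ENNReal.HolderConjugate p q] (hθ0 : θ ≠ 0) (hθ : θ ≤ 1)
    (hω : OmegaCompl θ ω) (hρ : Measurable ρ) (hρ0 : ∀ᵐ x ∂μ, 0 < ρ x)
    (hρs : ∀ s, μ {x | ρ x = s} = 0) :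
    ∃ C : ℝ≥0, ∀ h k : α → ℝ≥0∞, AEMeasurable h μ → AEMeasurable k μ →
      eLpNorm (fun r => ω r * tailNorm μ ρ p k r) θ (volume.restrict (Ioi 0)) ≤ 1 →
      ∫⁻ x, h x * k x ∂μ ≤ C * ⨆ t ∈ Ioi (0 : ℝ),
        eLpNorm h q (μ.restrict {x | ρ x < t}) * (headNorm θ ω t)⁻¹ := by
  obtain ⟨C, hC⟩ := exists_eLpNorm_shells_le hθ0 hω μ ρ p
  refine ⟨2 * C, fun h k hh hk hk1 => ?_⟩
  set W := headNorm θ ω with hW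
  set D := ⨆ t ∈ Ioi (0 : ℝ), eLpNorm h q (μ.restrict {x | ρ x < t}) * (W t)⁻¹ with hD
  -- The shell is exhausted by balls `{ρ < s}` with `W s ≤ 2 * 2^j`, which is the source of the
  -- factor 2.
  have hb : ∀ j : ℤ, eLpNorm h q (μ.restrict (ρ ⁻¹' dyadicShell W j)) ≤ D * 2 * 2 ^ j := by
    intro j
    refine eLpNorm_restrict_preimage_le_of_forall_lt hρs h fun s hs => ?_
    have hs0 := pos_of_mem_dyadicShell hθ0 hs
    have h1 : eLpNorm h q (μ.restrict {x | ρ x < s}) * (W s)⁻¹ ≤ D :=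
      le_iSup₂_of_le s hs0 le_rfl
    rw [← div_eq_mul_inv, ENNReal.div_le_iff_le_mul (Or.inl (hω.2 s hs0).1.ne')
      (Or.inl (hω.2 s hs0).2.ne)] at h1
    refine h1.trans ?_
    rw [mul_assoc]
    gcongr
    refine hs.2.trans_eq ?_
    rw [zpow_two_add, zpow_one, mul_comm]
  calc ∫⁻ x, h x * k x ∂μ
      ≤ ∑' j, eLpNorm h q (μ.restrict (ρ ⁻¹' dyadicShell W j)) *
          eLpNorm k p (μ.restrict (ρ ⁻¹' dyadicShell W j)) :=
        lintegral_mul_le_tsum_shells (headNorm_mono θ ω) hρ (ae_headNorm_pos_lt_top hω hρ0) hh hk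
    _ ≤ ∑' j, D * 2 * (2 ^ j * eLpNorm k p (μ.restrict (ρ ⁻¹' dyadicShell W j))) := by
        refine ENNReal.tsum_le_tsum fun j => ?_
        rw [← mul_assoc]
        gcongr
        exact hb j
    _ ≤ D * 2 * (C * 1) := by
        rw [ENNReal.tsum_mul_left]
        gcongr
        exact (tsum_le_eLpNorm_count hθ0 hθ _).trans ((hC k).trans (by gcongr))
    _ = _ := by push_cast; ring

theorem exists_lintegral_mul_le_eLpNorm_sublevelNorm [ENNReal.HolderConjugate p q] (hθ : 1 < θ)
    (hω : OmegaCompl θ ω) (hρ : Measurable ρ) (hρ0 : ∀ᵐ x ∂μ, 0 < ρ x) :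
    ∃ C : ℝ≥0, ∀ h k : α → ℝ≥0∞, AEMeasurable h μ → AEMeasurable k μ →
      eLpNorm (fun r => ω r * tailNorm μ ρ p k r) θ (volume.restrict (Ioi 0)) ≤ 1 →
      ∫⁻ x, h x * k x ∂μ ≤ C * eLpNorm
        (fun j : ℤ => (2 ^ j)⁻¹ * sublevelNorm μ ρ (headNorm θ ω) q h j) θ.conjExponent
        Measure.count := by
  have hθ0 : θ ≠ 0 := (zero_lt_one.trans hθ).ne'
  have hconj : ENNReal.HolderConjugate θ θ.conjExponent :=
    ENNReal.HolderConjugate.conjExponent hθ.le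
  obtain ⟨C, hC⟩ := exists_eLpNorm_shells_le hθ0 hω μ ρ p
  refine ⟨2 * C, fun h k hh hk hk1 => ?_⟩
  set W := headNorm θ ω with hW
  set a : ℤ → ℝ≥0∞ := fun j => (2 ^ j)⁻¹ * sublevelNorm μ ρ W q h j with ha
  have hb : ∀ j : ℤ, eLpNorm h q (μ.restrict (ρ ⁻¹' dyadicShell W j)) ≤
      a (j + 1) * 2 * 2 ^ j := by
    intro j
    have h2 : a (j + 1) * 2 * 2 ^ j = sublevelNorm μ ρ W q h (j + 1) := by
      have h3 : (2 : ℝ≥0∞) * 2 ^ j = 2 ^ (j + 1) := by rw [zpow_two_add, zpow_one, mul_comm]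
      rw [ha, mul_assoc, h3, mul_comm, ← mul_assoc,
        ENNReal.mul_inv_cancel (zpow_two_pos _).ne' (zpow_two_ne_top _), one_mul]
    rw [h2]
    exact eLpNorm_restrict_mono h fun x hx => hx.2
  calc ∫⁻ x, h x * k x ∂μ
      ≤ ∑' j, eLpNorm h q (μ.restrict (ρ ⁻¹' dyadicShell W j)) *
          eLpNorm k p (μ.restrict (ρ ⁻¹' dyadicShell W j)) :=
        lintegral_mul_le_tsum_shells (headNorm_mono θ ω) hρ (ae_headNorm_pos_lt_top hω hρ0) hh hk
    _ ≤ ∑' j, 2 * (a (j + 1) * (2 ^ j * eLpNorm k p (μ.restrict (ρ ⁻¹' dyadicShell W j)))) := by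
        refine ENNReal.tsum_le_tsum fun j => ?_
        calc _ ≤ (a (j + 1) * 2 * 2 ^ j) *
              eLpNorm k p (μ.restrict (ρ ⁻¹' dyadicShell W j)) := by gcongr; exact hb j
          _ = _ := by ring
    _ ≤ 2 * (eLpNorm a θ.conjExponent Measure.count * (C * 1)) := by
        rw [ENNReal.tsum_mul_left, ← lintegral_count]
        gcongr
        refine (lintegral_mul_le_eLpNorm_mul_eLpNorm (p := θ) (q := θ.conjExponent)
          (h := fun j => a (j + 1)) (Measurable.of_discrete).aemeasurable
          (Measurable.of_discrete).aemeasurable).trans ?_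
        gcongr
        · exact (eLpNorm_count_comp_equiv (Equiv.addRight (1 : ℤ)) a).le
        · exact (hC k).trans (by gcongr)
    _ = _ := by push_cast; ring

omit [SigmaFinite μ] in
/-- The set of the bounds for the pairing of `h` with the unit ball is homogeneous. -/
theorem lintegral_mul_le_mul_of_eLpNorm_tail_le (hp0 : p ≠ 0) (hθ0 : θ ≠ 0)
    (hω : OmegaCompl θ ω) {h k : α → ℝ≥0∞} (hh : Measurable h) (hk : Measurable k) {c b : ℝ≥0∞}
    (hc : ∀ k : α → ℝ≥0∞, Measurable k →
      eLpNorm (fun r => ω r * tailNorm μ ρ p k r) θ (volume.restrict (Ioi 0)) ≤ 1 →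
        ∫⁻ x, h x * k x ∂μ ≤ c)
    (hb0 : b ≠ 0) (hb : b ≠ ∞)
    (hkb : eLpNorm (fun r => ω r * tailNorm μ ρ p k r) θ (volume.restrict (Ioi 0)) ≤ b) :
    ∫⁻ x, h x * k x ∂μ ≤ c * b := by
  have h1 := hc (fun x => k x * b⁻¹) (hk.mul_const _) (by
    have : (fun r => ω r * tailNorm μ ρ p (fun x => k x * b⁻¹) r)
        = fun r => (ω r * tailNorm μ ρ p k r) * b⁻¹ := by
      ext r
      rw [tailNorm, eLpNorm_ennreal_mul_const hp0 hk.aemeasurable, ← mul_assoc]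
      rfl
    rw [this, eLpNorm_ennreal_mul_const (g := fun r => ω r * tailNorm μ ρ p k r) hθ0
      (hω.1.mul (tailNorm_antitone ρ p k).measurable.aemeasurable), ← div_eq_mul_inv]
    exact ENNReal.div_le_of_le_mul (by simpa using hkb))
  simp_rw [← mul_assoc] at h1
  rwa [lintegral_mul_const (f := fun x => h x * k x) _ (hh.mul hk), ← div_eq_mul_inv,
    ENNReal.div_le_iff_le_mul (Or.inl hb0) (Or.inl hb)] at h1

/-- A function of `L^p` norm at most 1 on `{ρ < t}`, extended by zero, has tail norms at most 1 for
`r < t` and zero for `r ≥ t`. Its Morrey-type norm is therefore at most `W(t)`, and the converse of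
Hölder applies. -/
theorem eLpNorm_ball_le_mul_headNorm [ENNReal.HolderConjugate p q] (hθ0 : θ ≠ 0)
    (hω : OmegaCompl θ ω) (hρ : Measurable ρ) {h : α → ℝ≥0∞} (hh : Measurable h) {c : ℝ≥0∞}
    (hc : ∀ k : α → ℝ≥0∞, Measurable k →
      eLpNorm (fun r => ω r * tailNorm μ ρ p k r) θ (volume.restrict (Ioi 0)) ≤ 1 →
        ∫⁻ x, h x * k x ∂μ ≤ c) {t : ℝ} (ht : 0 < t) :
    eLpNorm h q (μ.restrict {x | ρ x < t}) ≤ c * headNorm θ ω t := by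
  have hp0 := ENNReal.HolderConjugate.ne_zero p q
  have hBm : MeasurableSet {x | ρ x < t} := measurableSet_lt hρ measurable_const
  refine eLpNorm_le_of_forall_lintegral_mul_le (p := p) hh fun k hk hk1 => ?_
  have h1 : ∫⁻ x in {x | ρ x < t}, h x * k x ∂μ
      = ∫⁻ x, h x * {x | ρ x < t}.indicator k x ∂μ := by
    rw [← lintegral_indicator hBm]
    congr 1
    ext x
    by_cases hx : x ∈ {x | ρ x < t} <;> simp [indicator, hx]
  rw [h1]
  refine lintegral_mul_le_mul_of_eLpNorm_tail_le hp0 hθ0 hω hh (hk.indicator hBm) hc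
    (hω.2 t ht).1.ne' (hω.2 t ht).2.ne ?_
  have htail : ∀ r, tailNorm μ ρ p ({x | ρ x < t}.indicator k) r ≤
      (Iio t).indicator (fun _ => 1) r := by
    intro r
    by_cases hr : r < t
    · rw [indicator_of_mem (by exact hr)]
      refine le_trans ?_ hk1
      refine (eLpNorm_mono_measure _ Measure.restrict_le_self).trans ?_
      exact (eLpNorm_indicator_eq_eLpNorm_restrict hBm).le
    · rw [indicator_of_notMem (by exact hr)]
      refine (eLpNorm_ennreal_mono (g := fun _ => 0) ?_).trans (by simp)
      filter_upwards [ae_restrict_mem (measurableSet_le measurable_const hρ)] with x hx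
      have hx' : ¬ ρ x < t := not_lt.2 ((not_lt.1 hr).trans hx)
      simp [indicator, hx']
  calc _ ≤ eLpNorm ((Ioo 0 t).indicator ω) θ (volume.restrict (Ioi 0)) := by
        refine eLpNorm_ennreal_mono ?_
        filter_upwards [ae_restrict_mem measurableSet_Ioi] with r hr
        by_cases hrt : r < t
        · rw [indicator_of_mem (show r ∈ Ioo 0 t from ⟨hr, hrt⟩)]
          refine mul_le_of_le_one_right' ((htail r).trans ?_)
          exact indicator_le_self' (by simp) r
        · have h0 : tailNorm μ ρ p ({x | ρ x < t}.indicator k) r = 0 := by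
            have := htail r
            rw [indicator_of_notMem (by exact hrt)] at this
            simpa using this
          rw [h0, mul_zero]
          exact zero_le
    _ = headNorm θ ω t := by
        rw [eLpNorm_indicator_eq_eLpNorm_restrict measurableSet_Ioo,
          Measure.restrict_restrict measurableSet_Ioo, headNorm_eq_eLpNorm hθ0,
          inter_eq_left.2 fun r hr => hr.1]

theorem sublevelNorm_le_mul_zpow [ENNReal.HolderConjugate p q] (hθ0 : θ ≠ 0)
    (hω : OmegaCompl θ ω) (hρ : Measurable ρ) (hρ0 : ∀ᵐ x ∂μ, 0 < ρ x)
    (hρs : ∀ s, μ {x | ρ x = s} = 0) {h : α → ℝ≥0∞} (hh : Measurable h) {c : ℝ≥0∞}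
    (hc : ∀ k : α → ℝ≥0∞, Measurable k →
      eLpNorm (fun r => ω r * tailNorm μ ρ p k r) θ (volume.restrict (Ioi 0)) ≤ 1 →
        ∫⁻ x, h x * k x ∂μ ≤ c) (j : ℤ) :
    sublevelNorm μ ρ (headNorm θ ω) q h j ≤ c * 2 ^ j := by
  refine (eLpNorm_restrict_mono_ae (t := ρ ⁻¹' {r | 0 < r ∧ headNorm θ ω r ≤ 2 ^ j}) h ?_).trans
    (eLpNorm_restrict_preimage_le_of_forall_lt hρs h fun s hs => ?_)
  · filter_upwards [hρ0] with x hx hxj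
    exact ⟨hx, hxj⟩
  · exact (eLpNorm_ball_le_mul_headNorm hθ0 hω hρ hh hc hs.1).trans (by gcongr; exact hs.2)

/-- A discrete Hardy inequality. -/
theorem eLpNorm_hardy_le (hθ : 1 ≤ θ) (d : ℤ → ℝ≥0∞) :
    eLpNorm (fun i : ℤ => 2 ^ (i + 1) * ∑' j : ℤ, (Ioi i).indicator (fun j => (2 ^ j)⁻¹ * d j) j) θ
      Measure.count ≤ 2 * eLpNorm d θ Measure.count := by
  have hθ0 : θ ≠ 0 := (zero_lt_one.trans_le hθ).ne'
  -- With `j = i + 1 + m` the weight is `2^(i+1-j) = 2^{-m}`: the operator is a convolution with a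
  -- geometric sequence, so Minkowski and shift invariance give the factor `∑ 2^{-m} = 2`.
  have h1 : ∀ i : ℤ, 2 ^ (i + 1) * ∑' j : ℤ, (Ioi i).indicator (fun j => (2 ^ j)⁻¹ * d j) j =
      ∑' m : ℕ, d (i + 1 + m) * (2⁻¹ : ℝ≥0∞) ^ m := by
    intro i
    have hinj : Function.Injective fun m : ℕ => i + 1 + (m : ℤ) := fun a b hab => by
      simpa using hab
    rw [← hinj.tsum_eq (f := (Ioi i).indicator fun j => (2 ^ j)⁻¹ * d j), ← ENNReal.tsum_mul_left]
    · refine tsum_congr fun m => ?_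
      rw [indicator_of_mem (by simp; lia), zpow_two_add (i + 1) m,
        ENNReal.mul_inv (Or.inl (zpow_two_pos _).ne') (Or.inl (zpow_two_ne_top _)), zpow_natCast,
        ENNReal.inv_pow, mul_assoc, ← mul_assoc,
        ENNReal.mul_inv_cancel (zpow_two_pos _).ne' (zpow_two_ne_top _), one_mul, mul_comm]
    · intro j hj
      have hij : i < j := by
        by_contra h
        exact hj (indicator_of_notMem h _)
      exact ⟨(j - (i + 1)).toNat, by simp; lia⟩
  simp_rw [h1]
  refine (eLpNorm_tsum_le hθ (f := fun (m : ℕ) (i : ℤ) => d (i + 1 + m) * (2⁻¹ : ℝ≥0∞) ^ m)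
    fun m => Measurable.of_discrete).trans ?_
  have h2 : ∀ m : ℕ, eLpNorm (fun i : ℤ => d (i + 1 + m) * (2⁻¹ : ℝ≥0∞) ^ m) θ Measure.count =
      eLpNorm d θ Measure.count * (2⁻¹ : ℝ≥0∞) ^ m := by
    intro m
    rw [eLpNorm_ennreal_mul_const hθ0 (Measurable.of_discrete).aemeasurable]
    congr 1
    simp_rw [add_assoc]
    exact eLpNorm_count_comp_equiv (Equiv.addRight (1 + (m : ℤ))) d
  simp_rw [h2]
  rw [ENNReal.tsum_mul_left, ENNReal.tsum_geometric, ENNReal.one_sub_inv_two, inv_inv, mul_comm]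

/-- For `r` in shell `i`, the set `{r ≤ ρ}` lies in `{2^i < W ∘ ρ}`, so it meets the support of the
`j`-th piece only if `i < j`. -/
theorem tailNorm_tsum_le (hp : 1 ≤ p) (hρ : Measurable ρ) {W : ℝ → ℝ≥0∞} (hW : Monotone W)
    {b : ℤ → ℝ≥0∞} {k : ℤ → α → ℝ≥0∞} (hk : ∀ j, Measurable (k j))
    (hk1 : ∀ j, eLpNorm (k j) p (μ.restrict {x | W (ρ x) ≤ 2 ^ j}) ≤ 1) {i : ℤ} {r : ℝ}
    (hr : r ∈ dyadicShell W i) :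
    tailNorm μ ρ p (fun x => ∑' j, {x | W (ρ x) ≤ 2 ^ j}.indicator (k j) x * b j) r ≤
      ∑' j, (Ioi i).indicator b j := by
  have hDm : ∀ j : ℤ, MeasurableSet {x | W (ρ x) ≤ 2 ^ j} := fun j =>
    measurableSet_le (hW.measurable.comp hρ) measurable_const
  refine (eLpNorm_tsum_le hp fun j => ((hk j).indicator (hDm j)).mul_const (b j)).trans ?_
  refine ENNReal.tsum_le_tsum fun j => ?_
  rw [eLpNorm_ennreal_mul_const (zero_lt_one.trans_le hp).ne'
    ((hk j).indicator (hDm j)).aemeasurable]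
  by_cases hij : i < j
  · rw [indicator_of_mem (by exact hij)]
    refine mul_le_of_le_one_left' (le_trans ?_ (hk1 j))
    exact (eLpNorm_mono_measure _ Measure.restrict_le_self).trans
      (eLpNorm_indicator_eq_eLpNorm_restrict (hDm j)).le
  · have h0 : eLpNorm ({x | W (ρ x) ≤ 2 ^ j}.indicator (k j)) p (μ.restrict {x | r ≤ ρ x}) ≤ 0 := by
      refine (eLpNorm_ennreal_mono (g := fun _ => 0) ?_).trans (by simp)
      filter_upwards [ae_restrict_mem (measurableSet_le measurable_const hρ)] with x hx
      have h1 : (2 : ℝ≥0∞) ^ j ≤ 2 ^ i := ENNReal.zpow_le_of_le (by simp) (not_lt.1 hij)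
      have hx' : ¬ W (ρ x) ≤ 2 ^ j := not_le.2 (h1.trans_lt (hr.1.trans_le (hW hx)))
      simp [indicator, hx']
    rw [nonpos_iff_eq_zero.1 h0, zero_mul]
    exact zero_le

theorem eLpNorm_tail_le_of_forall_shell (hθ0 : θ ≠ 0) (hω : OmegaCompl θ ω) {N : ℝ → ℝ≥0∞}
    {e : ℤ → ℝ≥0∞} (hN : ∀ i, ∀ r ∈ dyadicShell (headNorm θ ω) i, N r ≤ e i) :
    eLpNorm (fun r => ω r * N r) θ (volume.restrict (Ioi 0)) ≤
      eLpNorm (fun i : ℤ => 2 ^ (i + 1) * e i) θ Measure.count := by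
  have hm := measurableSet_dyadicShell (headNorm_mono θ ω)
  rw [← iUnion_dyadicShell_headNorm hθ0 hω,
    eLpNorm_restrict_iUnion hθ0 hm (pairwise_disjoint_dyadicShell _)]
  refine eLpNorm_ennreal_mono (Filter.Eventually.of_forall fun i => ?_)
  have hsub : dyadicShell (headNorm θ ω) i ⊆ Ioi 0 := fun r hr => pos_of_mem_dyadicShell hθ0 hr
  calc _ ≤ eLpNorm (fun r => ω r * e i) θ (volume.restrict (dyadicShell (headNorm θ ω) i)) := by
        refine eLpNorm_ennreal_mono ?_
        filter_upwards [ae_restrict_mem (hm i)] with r hr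
        gcongr
        exact hN i r hr
    _ = eLpNorm ω θ (volume.restrict (dyadicShell (headNorm θ ω) i)) * e i :=
        eLpNorm_ennreal_mul_const hθ0 (hω.1.mono_measure (Measure.restrict_mono hsub le_rfl)) _
    _ ≤ _ := by
        gcongr
        exact (eLpNorm_restrict_mono (t := Ioi 0 ∩ {r | headNorm θ ω r ≤ 2 ^ (i + 1)}) ω
          fun r hr => ⟨hsub hr, hr.2⟩).trans (eLpNorm_sublevel_headNorm_le hθ0 _)

/-- Duality in `ℓ^θ`: the test function `∑ 2^{-j} d_j k_j` pairs with `h` like `d` with the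
sequence. The constant 4 is a 2 from half-extremal `k_j` times a 2 from Hardy's inequality. -/
theorem eLpNorm_sublevelNorm_le [ENNReal.HolderConjugate p q] (hp : 1 ≤ p) (hθ : 1 < θ)
    (hω : OmegaCompl θ ω) (hρ : Measurable ρ) (hρ0 : ∀ᵐ x ∂μ, 0 < ρ x)
    (hρs : ∀ s, μ {x | ρ x = s} = 0) {h : α → ℝ≥0∞} (hh : Measurable h) {c : ℝ≥0∞}
    (hc : ∀ k : α → ℝ≥0∞, Measurable k →
      eLpNorm (fun r => ω r * tailNorm μ ρ p k r) θ (volume.restrict (Ioi 0)) ≤ 1 →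
        ∫⁻ x, h x * k x ∂μ ≤ c) :
    eLpNorm (fun j : ℤ => (2 ^ j)⁻¹ * sublevelNorm μ ρ (headNorm θ ω) q h j) θ.conjExponent
      Measure.count ≤ 4 * c := by
  by_cases hct : c = ∞
  · simp [hct]
  have hθ0 : θ ≠ 0 := (zero_lt_one.trans hθ).ne'
  have hp0 : p ≠ 0 := (zero_lt_one.trans_le hp).ne'
  have hconj : ENNReal.HolderConjugate θ θ.conjExponent :=
    ENNReal.HolderConjugate.conjExponent hθ.le
  set W := headNorm θ ω with hW
  have hWm : Monotone W := headNorm_mono θ ω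
  have hDm : ∀ j : ℤ, MeasurableSet {x | W (ρ x) ≤ 2 ^ j} := fun j =>
    measurableSet_le (hWm.measurable.comp hρ) measurable_const
  -- The loss of a factor 2 makes the supremum attainable; finiteness of `c` makes the sublevel norm
  -- finite, so that its half is strictly smaller unless it vanishes.
  have hex : ∀ j : ℤ, ∃ k : α → ℝ≥0∞, Measurable k ∧
      eLpNorm k p (μ.restrict {x | W (ρ x) ≤ 2 ^ j}) ≤ 1 ∧
      sublevelNorm μ ρ W q h j / 2 ≤ ∫⁻ x in {x | W (ρ x) ≤ 2 ^ j}, h x * k x ∂μ := by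
    intro j
    by_contra hcon
    push Not at hcon
    have hfin : sublevelNorm μ ρ W q h j ≠ ∞ :=
      ((sublevelNorm_le_mul_zpow hθ0 hω hρ hρ0 hρs hh hc j).trans_lt
        (ENNReal.mul_lt_top (Ne.lt_top hct) (zpow_two_ne_top j).lt_top)).ne
    have h1 : sublevelNorm μ ρ W q h j ≤ sublevelNorm μ ρ W q h j / 2 :=
      eLpNorm_le_of_forall_lintegral_mul_le (p := p) hh fun k hk hk1 => (hcon k hk hk1).le
    have h2 : sublevelNorm μ ρ W q h j = 0 := by
      by_contra h0
      exact absurd (ENNReal.half_lt_self h0 hfin) h1.not_gt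
    have h3 := hcon 0 measurable_zero (by simp)
    rw [h2] at h3
    simp at h3
  choose k hkm hk1 hkh using hex
  refine eLpNorm_le_of_forall_lintegral_mul_le (p := θ) Measurable.of_discrete fun d _ hd => ?_
  rw [lintegral_count]
  set b : ℤ → ℝ≥0∞ := fun j => (2 ^ j)⁻¹ * d j with hb
  set K : α → ℝ≥0∞ := fun x => ∑' j, {x | W (ρ x) ≤ 2 ^ j}.indicator (k j) x * b j with hK
  have hKm : Measurable K :=
    Measurable.tsum fun j => ((hkm j).indicator (hDm j)).mul_const (b j)
  have hKX : eLpNorm (fun r => ω r * tailNorm μ ρ p K r) θ (volume.restrict (Ioi 0)) ≤ 2 := by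
    refine (eLpNorm_tail_le_of_forall_shell hθ0 hω fun i r hr =>
      tailNorm_tsum_le hp hρ hWm hkm hk1 hr).trans ?_
    exact (eLpNorm_hardy_le hθ.le d).trans (mul_le_of_le_one_right' hd)
  have h1 : ∫⁻ x, h x * K x ∂μ ≤ c * 2 :=
    lintegral_mul_le_mul_of_eLpNorm_tail_le hp0 hθ0 hω hh hKm hc (by simp) (by simp) hKX
  have h2 : ∫⁻ x, h x * K x ∂μ =
      ∑' j, (∫⁻ x in {x | W (ρ x) ≤ 2 ^ j}, h x * k j x ∂μ) * b j := by
    simp_rw [hK, ← ENNReal.tsum_mul_left]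
    rw [lintegral_tsum
      (f := fun j x => h x * ({x | W (ρ x) ≤ 2 ^ j}.indicator (k j) x * b j)) fun j =>
      (hh.mul (((hkm j).indicator (hDm j)).mul_const (b j))).aemeasurable]
    refine tsum_congr fun j => ?_
    rw [← lintegral_mul_const (f := fun x => h x * k j x) _ (hh.mul (hkm j)),
      ← lintegral_indicator (hDm j)]
    congr 1
    ext x
    by_cases hx : x ∈ {x | W (ρ x) ≤ 2 ^ j} <;> simp [indicator, hx, mul_assoc]
  have h3 : ∑' j, (2 ^ j)⁻¹ * sublevelNorm μ ρ W q h j * d j / 2 ≤ c * 2 := by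
    rw [h2] at h1
    refine le_trans (ENNReal.tsum_le_tsum fun j => ?_) h1
    calc _ = sublevelNorm μ ρ W q h j / 2 * b j := by
          simp only [hb, div_eq_mul_inv]
          ring
      _ ≤ _ := by gcongr; exact hkh j
  simp_rw [div_eq_mul_inv] at h3
  rw [ENNReal.tsum_mul_right, ← div_eq_mul_inv,
    ENNReal.div_le_iff_le_mul (Or.inl (by simp)) (Or.inl (by simp))] at h3
  refine h3.trans_eq ?_
  rw [mul_assoc, mul_comm]
  norm_num

end Duality

/-! ### Stieltjes measures as images of Lebesgue measure. -/

section GeneralizedInverse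

/-- The levels at which the generalized inverse of `F` on `(0,∞)` is defined. -/
def levelSet (F : StieltjesFunction (Ioi (0 : ℝ))) : Set ℝ :=
  {u | (∃ y, F y < u) ∧ ∃ z, u ≤ F z}

theorem measurableSet_levelSet (F : StieltjesFunction (Ioi (0 : ℝ))) :
    MeasurableSet (levelSet F) := by
  refine OrdConnected.measurableSet ⟨fun a ha b hb c hc => ?_⟩
  obtain ⟨y, hy⟩ := ha.1
  obtain ⟨z, hz⟩ := hb.2
  exact ⟨⟨y, hy.trans_le hc.1⟩, ⟨z, hc.2.trans hz⟩⟩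

theorem exists_generalizedInverse (F : StieltjesFunction (Ioi (0 : ℝ))) :
    ∃ τ : ℝ → Ioi (0 : ℝ), ∀ u ∈ levelSet F, ∀ z, u ≤ F z ↔ τ u ≤ z := by
  have key : ∀ u, ∃ t : Ioi (0 : ℝ), u ∈ levelSet F → ∀ z, u ≤ F z ↔ t ≤ z := by
    intro u
    by_cases hu : u ∈ levelSet F
    swap
    -- Off the level set the value is arbitrary.
    · exact ⟨⟨1, mem_Ioi.2 one_pos⟩, fun h => absurd h hu⟩
    obtain ⟨⟨y, hy⟩, ⟨z₀, hz₀⟩⟩ := hu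
    set S : Set ℝ := (↑) '' {z : Ioi (0 : ℝ) | u ≤ F z} with hS
    have hlow : ∀ r ∈ S, (y : ℝ) ≤ r := by
      rintro _ ⟨z, hz, rfl⟩
      by_contra hlt
      exact absurd (hy.trans_le hz) (F.mono (not_le.1 hlt).le).not_gt
    have hne : S.Nonempty := ⟨z₀, z₀, hz₀, rfl⟩
    have hbdd : BddBelow S := ⟨y, hlow⟩
    have ht0 : 0 < sInf S := lt_of_lt_of_le y.2 (le_csInf hne hlow)
    refine ⟨⟨sInf S, ht0⟩, fun _ z => ⟨fun hz => csInf_le hbdd ⟨z, hz, rfl⟩, fun hz => ?_⟩⟩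
    refine le_trans ?_ (F.mono hz)
    by_contra hlt
    -- Right continuity shows that the infimum of `{u ≤ F}` itself satisfies `u ≤ F`.
    have hev := (F.right_continuous ⟨sInf S, ht0⟩).eventually_lt_const (not_le.1 hlt)
    obtain ⟨t', ht', hsub⟩ := mem_nhdsGE_iff_exists_Ico_subset.1 hev
    obtain ⟨_, ⟨w, hw, rfl⟩, hwt⟩ := exists_lt_of_csInf_lt hne (show sInf S < (t' : ℝ) from ht')
    exact absurd (show F w < u from hsub ⟨csInf_le hbdd ⟨w, hw, rfl⟩, hwt⟩) (not_lt.2 hw)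
  choose τ hτ using key
  exact ⟨τ, hτ⟩

/-- The Galois relation turns the preimage of `(y,z]` into `(F y, F z]`, so the two measures agree
on half-open intervals. -/
theorem measure_eq_map_generalizedInverse (F : StieltjesFunction (Ioi (0 : ℝ)))
    {τ : ℝ → Ioi (0 : ℝ)} (hτ : ∀ u ∈ levelSet F, ∀ z, u ≤ F z ↔ τ u ≤ z) :
    AEMeasurable τ (volume.restrict (levelSet F)) ∧
      F.measure = (volume.restrict (levelSet F)).map τ := by
  have hm : AEMeasurable τ (volume.restrict (levelSet F)) :=
    aemeasurable_restrict_of_monotoneOn (measurableSet_levelSet F) fun u hu u' hu' huu' =>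
      (hτ u hu _).1 (huu'.trans ((hτ u' hu' _).2 le_rfl))
  refine ⟨hm, Measure.ext_of_Ioc' _ _ (fun y z _ => by simp [F.measure_Ioc]) fun y z _ => ?_⟩
  rw [F.measure_Ioc, Measure.map_apply_of_aemeasurable hm measurableSet_Ioc,
    Measure.restrict_apply' (measurableSet_levelSet F)]
  have : τ ⁻¹' Ioc y z ∩ levelSet F = Ioc (F y) (F z) := by
    ext u
    constructor
    · rintro ⟨⟨h1, h2⟩, hu⟩
      exact ⟨not_le.1 fun h => absurd ((hτ u hu y).1 h) (not_le.2 h1), (hτ u hu z).2 h2⟩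
    · rintro ⟨h1, h2⟩
      have hu : u ∈ levelSet F := ⟨⟨y, h1⟩, ⟨z, h2⟩⟩
      exact ⟨⟨not_le.1 fun h => absurd ((hτ u hu y).2 h) (not_le.2 h1), (hτ u hu z).1 h2⟩, hu⟩
  rw [this, Real.volume_Ioc]

end GeneralizedInverse

/-! ### Dyadic blocks of the negative half-line and their lengths. -/

section Blocks

/-- The dyadic blocks `(-2^{-js}, -2^{-(j+1)s}]` of the negative half-line. -/
def dyadicBlock (s : ℝ) (j : ℤ) : Set ℝ :=
  Ioc (-((2 : ℝ) ^ j) ^ (-s)) (-((2 : ℝ) ^ (j + 1)) ^ (-s))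

theorem two_zpow_rpow_neg (s : ℝ) (j : ℤ) :
    ((2 : ℝ) ^ j) ^ (-s) = ((2 : ℝ) ^ s) ^ (-j) := by
  rw [← Real.rpow_intCast, ← Real.rpow_intCast, ← Real.rpow_mul (by norm_num),
    ← Real.rpow_mul (by norm_num)]
  congr 1
  push_cast
  ring

theorem exists_mem_dyadicBlock {s u : ℝ} (hs : 0 < s) (hu : u < 0) : ∃ j, u ∈ dyadicBlock s j := by
  have hy : (1 : ℝ) < 2 ^ s := Real.one_lt_rpow (by norm_num) hs
  obtain ⟨n, h1, h2⟩ := exists_mem_Ico_zpow (neg_pos.2 hu) hy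
  refine ⟨-(n + 1), ?_, ?_⟩
  · rw [two_zpow_rpow_neg, neg_neg]
    linarith
  · rw [two_zpow_rpow_neg, show -(-(n + 1) + 1) = n by ring]
    linarith

theorem pairwise_disjoint_dyadicBlock {s : ℝ} (hs : 0 < s) :
    Pairwise (Function.onFun Disjoint (dyadicBlock s)) := by
  have key : ∀ i j : ℤ, i < j → Disjoint (dyadicBlock s i) (dyadicBlock s j) := by
    intro i j hij
    rw [Set.disjoint_left]
    rintro u ⟨_, h1⟩ ⟨h2, _⟩
    have h3 : ((2 : ℝ) ^ j) ^ (-s) ≤ ((2 : ℝ) ^ (i + 1)) ^ (-s) :=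
      Real.rpow_le_rpow_of_nonpos (by positivity)
        (zpow_le_zpow_right₀ (by norm_num) (by lia)) (by linarith)
    linarith
  intro i j hij
  rcases lt_or_gt_of_ne hij with h | h
  · exact key i j h
  · exact (key j i h).symm

theorem toReal_two_zpow (j : ℤ) : ((2 : ℝ≥0∞) ^ j).toReal = (2 : ℝ) ^ j := by
  rw [← ENNReal.rpow_intCast, ← ENNReal.toReal_rpow, Real.rpow_intCast, ENNReal.toReal_ofNat]

theorem ofReal_two_zpow_rpow_neg (s : ℝ) (j : ℤ) :
    ENNReal.ofReal (((2 : ℝ) ^ j) ^ (-s)) = ((2 : ℝ≥0∞) ^ j)⁻¹ ^ s := by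
  have h2 : ENNReal.ofReal ((2 : ℝ) ^ j) = (2 : ℝ≥0∞) ^ j := by
    rw [← ENNReal.ofReal_toReal (zpow_two_ne_top j), toReal_two_zpow]
  rw [← ENNReal.ofReal_rpow_of_pos (by positivity), h2, ENNReal.inv_rpow, ENNReal.rpow_neg]

theorem volume_dyadicBlock_le (s : ℝ) (j : ℤ) :
    volume (dyadicBlock s j) ≤ ((2 : ℝ≥0∞) ^ j)⁻¹ ^ s := by
  rw [dyadicBlock, Real.volume_Ioc, ← ofReal_two_zpow_rpow_neg]
  apply ENNReal.ofReal_le_ofReal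
  have : 0 ≤ ((2 : ℝ) ^ (j + 1)) ^ (-s) := by positivity
  linarith

/-- For `s ≥ 1` the right endpoint is at most half the left one in absolute value, so the block has
at least half the length of `(-2^{-js}, 0]`. -/
theorem le_volume_dyadicBlock {s : ℝ} (hs : 1 ≤ s) (j : ℤ) :
    ((2 : ℝ≥0∞) ^ j)⁻¹ ^ s ≤ 2 * volume (dyadicBlock s j) := by
  have h2 : (2 : ℝ) ≤ 2 ^ s := by
    simpa using Real.rpow_le_rpow_of_exponent_le (x := 2) (by norm_num) hs
  rw [dyadicBlock, Real.volume_Ioc, ← ofReal_two_zpow_rpow_neg,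
    show (2 : ℝ≥0∞) = ENNReal.ofReal 2 by simp, ← ENNReal.ofReal_mul (by norm_num)]
  apply ENNReal.ofReal_le_ofReal
  have h3 : ((2 : ℝ) ^ j) ^ (-s) = 2 ^ s * ((2 : ℝ) ^ (j + 1)) ^ (-s) := by
    rw [two_zpow_rpow_neg, two_zpow_rpow_neg, neg_add, zpow_add₀ (by positivity), zpow_neg_one,
      mul_comm, mul_assoc, inv_mul_cancel₀ (by positivity), mul_one]
  have h4 : 0 ≤ ((2 : ℝ) ^ (j + 1)) ^ (-s) := by positivity
  nlinarith

end Blocks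

/-! ### Comparison of the Stieltjes function with `-W^{-θ'}`. -/

section HeadPower

variable {θ : ℝ≥0∞} {ω : ℝ → ℝ≥0∞}

/-- The right-continuous function defining the measure `d(-‖ω‖_{θ,(0,t+)}^{-θ'})`. -/
noncomputable def headStieltjes (hω : OmegaCompl θ ω) : StieltjesFunction (Ioi (0 : ℝ)) :=
  (negHeadPower_mono hω).stieltjesFunction

theorem stieltjesMeasure_negHeadPower (hω : OmegaCompl θ ω) :
    stieltjesMeasure (negHeadPower θ ω) = (headStieltjes hω).measure := by
  rw [stieltjesMeasure, dif_pos (negHeadPower_mono hω), headStieltjes]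

theorem neg_rpow_headNorm_le (hω : OmegaCompl θ ω) (t : Ioi (0 : ℝ)) :
    -(headNorm θ ω t).toReal ^ (-θ.conjExponent.toReal) ≤ headStieltjes hω t := by
  refine le_trans ?_ ((negHeadPower_mono hω).le_rightLim (le_refl t))
  have ht := hω.2 t t.2
  exact neg_le_neg (Real.rpow_le_rpow_of_nonpos (ENNReal.toReal_pos ht.1.ne' ht.2.ne)
    (ENNReal.toReal_mono (headNormRight_pos_lt_top hω t.2).2.ne
      ((headNorm_mono θ ω).le_rightLim le_rfl)) (neg_nonpos.2 ENNReal.toReal_nonneg))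

/-- Together with `neg_rpow_headNorm_le` this traps the right-continuous version between values of
`-W^{-θ'}`; the strict inequality `t < t'` leaves room for a jump at `t`. -/
theorem le_neg_rpow_headNorm (hω : OmegaCompl θ ω) {t t' : Ioi (0 : ℝ)} (h : t < t') :
    headStieltjes hω t ≤ -(headNorm θ ω t').toReal ^ (-θ.conjExponent.toReal) := by
  obtain ⟨m, hm1, hm2⟩ := exists_between h
  refine ((negHeadPower_mono hω).rightLim_le hm1).trans ?_
  have hm := headNormRight_pos_lt_top hω m.2
  exact neg_le_neg (Real.rpow_le_rpow_of_nonpos (ENNReal.toReal_pos hm.1.ne' hm.2.ne)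
    (ENNReal.toReal_mono (hω.2 t' t'.2).2.ne ((headNorm_mono θ ω).rightLim_le hm2))
    (neg_nonpos.2 ENNReal.toReal_nonneg))

theorem headNorm_le_iff (hω : OmegaCompl θ ω) {s : ℝ} (hs : 0 < s) (t : Ioi (0 : ℝ)) (j : ℤ) :
    -(headNorm θ ω t).toReal ^ (-s) ≤ -((2 : ℝ) ^ j) ^ (-s) ↔ headNorm θ ω t ≤ 2 ^ j := by
  have ht := hω.2 t t.2
  rw [neg_le_neg_iff, Real.rpow_le_rpow_iff_of_neg (by positivity)
    (ENNReal.toReal_pos ht.1.ne' ht.2.ne) (by linarith),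
    ← ENNReal.toReal_le_toReal ht.2.ne (zpow_two_ne_top j), toReal_two_zpow]

end HeadPower

/-! ### The Stieltjes integral against the discrete sum. -/

section Stieltjes

variable {α : Type*} [MeasurableSpace α] {μ : Measure α} {ρ : α → ℝ}
  {q θ : ℝ≥0∞} {ω : ℝ → ℝ≥0∞}

theorem one_le_toReal_conjExponent (hθ : 1 < θ) :
    θ.conjExponent ≠ ∞ ∧ 1 ≤ θ.conjExponent.toReal := by
  have hconj : ENNReal.HolderConjugate θ θ.conjExponent :=
    ENNReal.HolderConjugate.conjExponent hθ.le
  have h1 : θ.conjExponent ≠ ∞ :=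
    ((ENNReal.HolderConjugate.lt_top_iff_one_lt θ.conjExponent θ).2 hθ).ne
  exact ⟨h1, by simpa using
    ENNReal.toReal_mono h1 (ENNReal.HolderConjugate.one_le θ.conjExponent θ)⟩

theorem headNorm_le_total (hθ0 : θ ≠ 0) (t : ℝ) :
    headNorm θ ω t ≤ eLpNorm ω θ (volume.restrict (Ioi 0)) := by
  rw [headNorm_eq_eLpNorm hθ0]
  exact eLpNorm_restrict_mono ω fun r hr => hr.1

theorem total_le_of_forall_headNorm_le (hθ0 : θ ≠ 0) {c : ℝ≥0∞}
    (h : ∀ t, 0 < t → headNorm θ ω t ≤ c) : eLpNorm ω θ (volume.restrict (Ioi 0)) ≤ c :=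
  (eLpNorm_restrict_mono (t := Ioi 0 ∩ {r | headNorm θ ω r ≤ c}) ω fun r hr => ⟨hr, h r hr⟩).trans
    (eLpNorm_sublevel_headNorm_le hθ0 c)

theorem sublevelNorm_eq_of_total_le (hθ0 : θ ≠ 0) {j : ℤ}
    (hj : eLpNorm ω θ (volume.restrict (Ioi 0)) ≤ 2 ^ j) (h : α → ℝ≥0∞) :
    sublevelNorm μ ρ (headNorm θ ω) q h j = eLpNorm h q μ := by
  have : {x | headNorm θ ω (ρ x) ≤ 2 ^ j} = univ :=
    eq_univ_of_forall fun x => (headNorm_le_total hθ0 _).trans hj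
  rw [sublevelNorm, this, Measure.restrict_univ]

theorem ballNorm_le_sublevelNorm (hθ : 1 < θ) (hω : OmegaCompl θ ω) (h : α → ℝ≥0∞)
    (hρ0 : ∀ᵐ x ∂μ, 0 < ρ x) {τ : ℝ → Ioi (0 : ℝ)}
    (hτ : ∀ u ∈ levelSet (headStieltjes hω), ∀ z, u ≤ headStieltjes hω z ↔ τ u ≤ z)
    {j : ℤ} {u : ℝ} (hu : u ∈ levelSet (headStieltjes hω))
    (huj : u ∈ dyadicBlock θ.conjExponent.toReal j) :
    eLpNorm h q (μ.restrict {x | ρ x < τ u}) ≤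
      sublevelNorm μ ρ (headNorm θ ω) q h (j + 1) := by
  have hs := (one_le_toReal_conjExponent hθ).2
  refine eLpNorm_restrict_mono_ae h ?_
  filter_upwards [hρ0] with x hx hxτ
  have h1 : headStieltjes hω ⟨ρ x, hx⟩ < u := by
    by_contra hcon
    exact absurd ((hτ u hu _).1 (not_lt.1 hcon)) (not_le.2 hxτ)
  exact (headNorm_le_iff hω (by linarith) ⟨ρ x, hx⟩ (j + 1)).1
    (((neg_rpow_headNorm_le hω _).trans h1.le).trans huj.2)

theorem sublevelNorm_le_ballNorm (hθ : 1 < θ) (hω : OmegaCompl θ ω) (h : α → ℝ≥0∞)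
    (hρ0 : ∀ᵐ x ∂μ, 0 < ρ x) (hρs : ∀ s, μ {x | ρ x = s} = 0) {τ : ℝ → Ioi (0 : ℝ)}
    (hτ : ∀ u ∈ levelSet (headStieltjes hω), ∀ z, u ≤ headStieltjes hω z ↔ τ u ≤ z)
    {j : ℤ} {u : ℝ} (hu : u ∈ levelSet (headStieltjes hω))
    (huj : u ∈ dyadicBlock θ.conjExponent.toReal j) :
    sublevelNorm μ ρ (headNorm θ ω) q h j ≤ eLpNorm h q (μ.restrict {x | ρ x < τ u}) := by
  have hs := (one_le_toReal_conjExponent hθ).2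
  refine eLpNorm_restrict_mono_ae h ?_
  -- On the sphere `ρ = τ u` a jump could break the inclusion, but that sphere is null.
  have hne : ∀ᵐ x ∂μ, ρ x ≠ τ u := by rw [ae_iff]; simpa using hρs (τ u)
  filter_upwards [hρ0, hne] with x hx hxne hxj
  by_contra hcon
  have hlt : τ u < ⟨ρ x, hx⟩ := Subtype.mk_lt_mk.2 (lt_of_le_of_ne (not_lt.1 hcon) (Ne.symm hxne))
  have h1 := ((hτ u hu (τ u)).2 le_rfl).trans (le_neg_rpow_headNorm hω hlt)
  have h2 := (headNorm_le_iff (s := θ.conjExponent.toReal) hω (by linarith) ⟨ρ x, hx⟩ j).2 hxj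
  exact absurd (h1.trans h2) (not_le.2 huj.1)

theorem levelSet_headStieltjes_neg (hω : OmegaCompl θ ω) {u : ℝ}
    (hu : u ∈ levelSet (headStieltjes hω)) : u < 0 := by
  obtain ⟨z, hz⟩ := hu.2
  have hlt : z < ⟨(z : ℝ) + 1, mem_Ioi.2 (by linarith [mem_Ioi.1 z.2])⟩ :=
    Subtype.mk_lt_mk.2 (lt_add_one _)
  refine (hz.trans (le_neg_rpow_headNorm hω hlt)).trans_lt ?_
  have ht := hω.2 ((z : ℝ) + 1) (by linarith [mem_Ioi.1 z.2])
  exact neg_neg_of_pos (Real.rpow_pos_of_pos (ENNReal.toReal_pos ht.1.ne' ht.2.ne) _)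

/-- A level `u` is missed either from below, and then almost no point satisfies `W ∘ ρ ≤ 2^j`, or
from above, and then `W` never exceeds `2^(j+1)`. -/
theorem not_mem_levelSet_headStieltjes (hθ : 1 < θ) (hω : OmegaCompl θ ω) (h : α → ℝ≥0∞)
    (hρ0 : ∀ᵐ x ∂μ, 0 < ρ x) {j : ℤ} {u : ℝ} (hu : u ∉ levelSet (headStieltjes hω))
    (huj : u ∈ dyadicBlock θ.conjExponent.toReal j) :
    sublevelNorm μ ρ (headNorm θ ω) q h j = 0 ∨
      eLpNorm ω θ (volume.restrict (Ioi 0)) ≤ 2 ^ (j + 1) := by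
  have hs := (one_le_toReal_conjExponent hθ).2
  by_cases h1 : ∃ y, headStieltjes hω y < u
  · right
    refine total_le_of_forall_headNorm_le (zero_lt_one.trans hθ).ne' fun t ht => ?_
    have h2 : headStieltjes hω ⟨t, ht⟩ < u := by
      by_contra hcon
      exact hu ⟨h1, _, not_lt.1 hcon⟩
    exact (headNorm_le_iff hω (by linarith) ⟨t, ht⟩ (j + 1)).1
      (((neg_rpow_headNorm_le hω _).trans h2.le).trans huj.2)
  · left
    push Not at h1
    rw [sublevelNorm, Measure.restrict_eq_zero.2, eLpNorm_measure_zero]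
    refine measure_mono_null (fun x hxj => ?_) (ae_iff.1 hρ0)
    intro hx
    have hx2 : (⟨ρ x / 2, mem_Ioi.2 (by linarith)⟩ : Ioi (0 : ℝ)) < ⟨ρ x, hx⟩ :=
      Subtype.mk_lt_mk.2 (by linarith)
    have h2 := (h1 _).trans (le_neg_rpow_headNorm hω hx2)
    have h3 := (headNorm_le_iff (s := θ.conjExponent.toReal) hω (by linarith) ⟨ρ x, hx⟩ j).2 hxj
    exact absurd (h2.trans h3) (not_le.2 huj.1)

theorem ballNorm_monotone (h : α → ℝ≥0∞) :
    Monotone fun t : Ioi (0 : ℝ) => eLpNorm h q (μ.restrict {x | ρ x < t}) := fun _ _ hst =>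
  eLpNorm_restrict_mono h fun _ hx =>
    lt_of_lt_of_le (show ρ _ < _ from hx) (Subtype.coe_le_coe.2 hst)

theorem lintegral_stieltjes_eq (hω : OmegaCompl θ ω) {τ : ℝ → Ioi (0 : ℝ)}
    (hτ : ∀ u ∈ levelSet (headStieltjes hω), ∀ z, u ≤ headStieltjes hω z ↔ τ u ≤ z)
    (s : ℝ) (h : α → ℝ≥0∞) :
    ∫⁻ t : Ioi (0 : ℝ), eLpNorm h q (μ.restrict {x | ρ x < t}) ^ s
        ∂(stieltjesMeasure (negHeadPower θ ω)) =
      ∫⁻ u in levelSet (headStieltjes hω), eLpNorm h q (μ.restrict {x | ρ x < τ u}) ^ s := by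
  obtain ⟨hτm, hmap⟩ := measure_eq_map_generalizedInverse _ hτ
  rw [stieltjesMeasure_negHeadPower hω, hmap, lintegral_map' _ hτm]
  exact ((ballNorm_monotone h).measurable.pow_const s).aemeasurable

theorem measurableSet_dyadicBlock (s : ℝ) (j : ℤ) : MeasurableSet (dyadicBlock s j) :=
  measurableSet_Ioc

theorem lintegral_stieltjes_eq_tsum (hθ : 1 < θ) (hω : OmegaCompl θ ω) {τ : ℝ → Ioi (0 : ℝ)}
    (hτ : ∀ u ∈ levelSet (headStieltjes hω), ∀ z, u ≤ headStieltjes hω z ↔ τ u ≤ z)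
    (h : α → ℝ≥0∞) :
    ∫⁻ t : Ioi (0 : ℝ), eLpNorm h q (μ.restrict {x | ρ x < t}) ^ θ.conjExponent.toReal
        ∂(stieltjesMeasure (negHeadPower θ ω)) =
      ∑' j, ∫⁻ u in dyadicBlock θ.conjExponent.toReal j ∩ levelSet (headStieltjes hω),
        eLpNorm h q (μ.restrict {x | ρ x < τ u}) ^ θ.conjExponent.toReal := by
  have hs := (one_le_toReal_conjExponent hθ).2
  have hs0 : 0 < θ.conjExponent.toReal := by linarith
  rw [lintegral_stieltjes_eq hω hτ, ← lintegral_iUnion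
    (fun j => (measurableSet_dyadicBlock _ j).inter (measurableSet_levelSet _))
    (fun i j hij => (pairwise_disjoint_dyadicBlock hs0 hij).mono inter_subset_left
      inter_subset_left), ← iUnion_inter]
  congr 2
  refine (inter_eq_right.2 fun u hu => ?_).symm
  exact mem_iUnion.2 (exists_mem_dyadicBlock hs0 (levelSet_headStieltjes_neg hω hu))

/-- For `u` in block `j` the ball of radius `τ u` lies a.e. in the sublevel set of index `j + 1`,
and the block has length at most `2^{-js}`. The shift of index costs the factor 2. -/
theorem stieltjes_le_sublevel (hθ : 1 < θ) (hω : OmegaCompl θ ω) (h : α → ℝ≥0∞)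
    (hρ0 : ∀ᵐ x ∂μ, 0 < ρ x) :
    (∫⁻ t : Ioi (0 : ℝ), eLpNorm h q (μ.restrict {x | ρ x < t}) ^ θ.conjExponent.toReal
        ∂(stieltjesMeasure (negHeadPower θ ω))) ^ (1 / θ.conjExponent.toReal) ≤
      2 * eLpNorm (fun j : ℤ => (2 ^ j)⁻¹ * sublevelNorm μ ρ (headNorm θ ω) q h j)
        θ.conjExponent Measure.count := by
  obtain ⟨hst, hs⟩ := one_le_toReal_conjExponent hθ
  set s := θ.conjExponent.toReal with hs_def
  have hs0 : 0 < s := by linarith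
  have hθ'0 : θ.conjExponent ≠ 0 := fun h0 => by simp [hs_def, h0] at hs0
  obtain ⟨τ, hτ⟩ := exists_generalizedInverse (headStieltjes hω)
  set a : ℤ → ℝ≥0∞ := fun j => (2 ^ j)⁻¹ * sublevelNorm μ ρ (headNorm θ ω) q h j with ha
  rw [lintegral_stieltjes_eq_tsum hθ hω hτ, one_div, ENNReal.rpow_inv_le_iff hs0,
    ENNReal.mul_rpow_of_nonneg _ _ hs0.le, eLpNorm_ennreal_rpow hθ'0 hst, lintegral_count,
    ← (Equiv.addRight (1 : ℤ)).tsum_eq fun j => a j ^ θ.conjExponent.toReal,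
    ← ENNReal.tsum_mul_left]
  refine ENNReal.tsum_le_tsum fun j => ?_
  calc _ ≤ ∫⁻ u in dyadicBlock s j ∩ levelSet (headStieltjes hω),
          sublevelNorm μ ρ (headNorm θ ω) q h (j + 1) ^ s := by
        refine setLIntegral_mono' ((measurableSet_dyadicBlock _ j).inter
          (measurableSet_levelSet _)) fun u hu => ?_
        gcongr
        exact ballNorm_le_sublevelNorm hθ hω h hρ0 hτ hu.2 hu.1
    _ ≤ sublevelNorm μ ρ (headNorm θ ω) q h (j + 1) ^ s * ((2 : ℝ≥0∞) ^ j)⁻¹ ^ s := by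
        rw [setLIntegral_const]
        gcongr
        exact (measure_mono inter_subset_left).trans (volume_dyadicBlock_le s j)
    _ = _ := by
        rw [← ENNReal.mul_rpow_of_nonneg _ _ hs0.le, ← ENNReal.mul_rpow_of_nonneg _ _ hs0.le]
        congr 1
        have : ((2 : ℝ≥0∞) ^ j)⁻¹ = 2 * (2 ^ (j + 1))⁻¹ := by
          rw [zpow_two_add, zpow_one, ENNReal.mul_inv (Or.inl (zpow_two_pos j).ne')
            (Or.inl (zpow_two_ne_top j)), mul_comm, mul_assoc,
            ENNReal.inv_mul_cancel (by simp) (by simp), mul_one]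
        simp only [ha, Equiv.coe_addRight]
        rw [this]
        ring

theorem total_pos (hθ0 : θ ≠ 0) (hω : OmegaCompl θ ω) :
    0 < eLpNorm ω θ (volume.restrict (Ioi 0)) :=
  (hω.2 1 one_pos).1.trans_le (headNorm_le_total hθ0 1)

/-- If the total norm `T` of `ω` is finite, a single term suffices: when `2^j < T ≤ 2^(j+1)`, the
sublevel set of index `j + 1` is the whole space. -/
theorem total_le_sublevel (hθ : 1 < θ) (hω : OmegaCompl θ ω) (h : α → ℝ≥0∞) :
    eLpNorm h q μ / eLpNorm ω θ (volume.restrict (Ioi 0)) ≤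
      2 * eLpNorm (fun j : ℤ => (2 ^ j)⁻¹ * sublevelNorm μ ρ (headNorm θ ω) q h j)
        θ.conjExponent Measure.count := by
  have hθ0 : θ ≠ 0 := (zero_lt_one.trans hθ).ne'
  by_cases hT : eLpNorm ω θ (volume.restrict (Ioi 0)) = ∞
  · simp [hT]
  have hs := (one_le_toReal_conjExponent hθ).2
  have hθ'0 : θ.conjExponent ≠ 0 := fun h0 => by
    rw [h0] at hs
    norm_num at hs
  obtain ⟨j, hj1, hj2⟩ := ENNReal.exists_mem_Ioc_zpow (y := 2) (total_pos hθ0 hω).ne' hT (by simp)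
    (by simp)
  refine le_trans ?_ (mul_le_mul_right (le_eLpNorm_count hθ'0 _ (j + 1)) _)
  rw [sublevelNorm_eq_of_total_le hθ0 hj2, zpow_two_add, zpow_one,
    ENNReal.mul_inv (Or.inl (zpow_two_pos j).ne') (Or.inl (zpow_two_ne_top j)), ← mul_assoc,
    mul_comm _ (2⁻¹ : ℝ≥0∞), ← mul_assoc, ENNReal.mul_inv_cancel (by simp) (by simp), one_mul,
    mul_comm, div_eq_mul_inv]
  gcongr

theorem tsum_indicator_zpow_rpow_le {s : ℝ} (hs : 1 ≤ s) (i : ℤ) :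
    ∑' j : ℤ, (Ici i).indicator (fun j => ((2 : ℝ≥0∞) ^ j)⁻¹ ^ s) j ≤ 2 * ((2 : ℝ≥0∞) ^ i)⁻¹ ^ s := by
  have hs0 : 0 < s := by linarith
  have hinj : Function.Injective fun m : ℕ => i + (m : ℤ) := fun a b hab => by simpa using hab
  rw [← hinj.tsum_eq]
  · calc _ ≤ ∑' m : ℕ, ((2 : ℝ≥0∞) ^ i)⁻¹ ^ s * 2⁻¹ ^ m := by
          refine ENNReal.tsum_le_tsum fun m => ?_
          rw [indicator_of_mem (by simp), zpow_two_add,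
            ENNReal.mul_inv (Or.inl (zpow_two_pos _).ne') (Or.inl (zpow_two_ne_top _)), zpow_natCast,
            ENNReal.mul_rpow_of_nonneg _ _ hs0.le, ENNReal.inv_pow]
          gcongr
          calc ((2⁻¹ : ℝ≥0∞) ^ m) ^ s ≤ ((2⁻¹ : ℝ≥0∞) ^ m) ^ (1 : ℝ) :=
                ENNReal.rpow_le_rpow_of_exponent_ge (pow_le_one₀ zero_le (by simp)) hs
            _ = _ := ENNReal.rpow_one _
      _ = _ := by
          rw [ENNReal.tsum_mul_left, ENNReal.tsum_geometric, ENNReal.one_sub_inv_two, inv_inv,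
            mul_comm]
  · intro j hj
    have hij : i ≤ j := by
      by_contra h
      exact hj (indicator_of_notMem (mt mem_Ici.1 h) _)
    exact ⟨(j - i).toNat, by simp; lia⟩

theorem rpow_sublevelNorm_le (hθ : 1 < θ) (hω : OmegaCompl θ ω) (h : α → ℝ≥0∞)
    (hρ0 : ∀ᵐ x ∂μ, 0 < ρ x) (hρs : ∀ s, μ {x | ρ x = s} = 0) {τ : ℝ → Ioi (0 : ℝ)}
    (hτ : ∀ u ∈ levelSet (headStieltjes hω), ∀ z, u ≤ headStieltjes hω z ↔ τ u ≤ z) (j : ℤ) :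
    ((2 ^ j)⁻¹ * sublevelNorm μ ρ (headNorm θ ω) q h j) ^ θ.conjExponent.toReal ≤
      2 * (∫⁻ u in dyadicBlock θ.conjExponent.toReal j ∩ levelSet (headStieltjes hω),
        eLpNorm h q (μ.restrict {x | ρ x < τ u}) ^ θ.conjExponent.toReal) +
      {j : ℤ | eLpNorm ω θ (volume.restrict (Ioi 0)) ≤ 2 ^ (j + 1)}.indicator
        (fun j => ((2 ^ j)⁻¹ : ℝ≥0∞) ^ θ.conjExponent.toReal) j *
          eLpNorm h q μ ^ θ.conjExponent.toReal := by
  have hs := (one_le_toReal_conjExponent hθ).2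
  set s := θ.conjExponent.toReal with hs_def
  have hs0 : 0 < s := by linarith
  rw [ENNReal.mul_rpow_of_nonneg _ _ hs0.le]
  -- A block inside the level set is absorbed by the integral; any other block contributes zero or
  -- is charged to the total norm.
  by_cases hsub : dyadicBlock s j ⊆ levelSet (headStieltjes hω)
  · refine le_add_right ?_
    rw [inter_eq_left.2 hsub]
    calc _ ≤ 2 * volume (dyadicBlock s j) * sublevelNorm μ ρ (headNorm θ ω) q h j ^ s := by
          gcongr
          exact le_volume_dyadicBlock hs j
      _ = 2 * ∫⁻ _ in dyadicBlock s j, sublevelNorm μ ρ (headNorm θ ω) q h j ^ s := by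
          rw [setLIntegral_const]
          ring
      _ ≤ _ := by
          gcongr 2 * ?_
          refine setLIntegral_mono' (measurableSet_dyadicBlock _ j) fun u hu => ?_
          gcongr
          exact sublevelNorm_le_ballNorm hθ hω h hρ0 hρs hτ (hsub hu) hu
  · obtain ⟨u, huj, hu⟩ := not_subset.1 hsub
    rcases not_mem_levelSet_headStieltjes (q := q) hθ hω h hρ0 hu huj with h0 | h1
    · rw [h0, ENNReal.zero_rpow_of_pos hs0, mul_zero]
      exact zero_le
    · refine le_add_left ?_
      rw [indicator_of_mem (by exact h1)]
      gcongr
      exact eLpNorm_mono_measure h Measure.restrict_le_self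

theorem sublevel_le_stieltjes_add_total (hθ : 1 < θ) (hω : OmegaCompl θ ω) (h : α → ℝ≥0∞)
    (hρ0 : ∀ᵐ x ∂μ, 0 < ρ x) (hρs : ∀ s, μ {x | ρ x = s} = 0) :
    eLpNorm (fun j : ℤ => (2 ^ j)⁻¹ * sublevelNorm μ ρ (headNorm θ ω) q h j)
        θ.conjExponent Measure.count ≤
      4 * ((∫⁻ t : Ioi (0 : ℝ), eLpNorm h q (μ.restrict {x | ρ x < t}) ^ θ.conjExponent.toReal
        ∂(stieltjesMeasure (negHeadPower θ ω))) ^ (1 / θ.conjExponent.toReal) +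
      eLpNorm h q μ / eLpNorm ω θ (volume.restrict (Ioi 0))) := by
  have hθ0 : θ ≠ 0 := (zero_lt_one.trans hθ).ne'
  obtain ⟨hst, hs⟩ := one_le_toReal_conjExponent hθ
  obtain ⟨τ, hτ⟩ := exists_generalizedInverse (headStieltjes hω)
  have hkey := fun j => rpow_sublevelNorm_le (q := q) hθ hω h hρ0 hρs hτ j
  have hI := lintegral_stieltjes_eq_tsum (μ := μ) (ρ := ρ) (q := q) hθ hω hτ h
  set I := ∫⁻ t : Ioi (0 : ℝ), eLpNorm h q (μ.restrict {x | ρ x < t}) ^ θ.conjExponent.toReal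
    ∂(stieltjesMeasure (negHeadPower θ ω)) with hI_def
  set s := θ.conjExponent.toReal with hs_def
  have hs0 : 0 < s := by linarith
  have hθ'0 : θ.conjExponent ≠ 0 := fun h0 => by simp [hs_def, h0] at hs0
  set T := eLpNorm ω θ (volume.restrict (Ioi 0)) with hT_def
  set E := eLpNorm h q μ / T with hE
  -- The exceptional indices satisfy `j ≥ i` when `2^i < T ≤ 2^(i+1)`, so they form a geometric tail
  -- of size `T^{-s}`; there are none when `T = ∞`.
  have htail : (∑' j : ℤ, {j : ℤ | T ≤ 2 ^ (j + 1)}.indicator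
      (fun j => ((2 ^ j)⁻¹ : ℝ≥0∞) ^ s) j) * eLpNorm h q μ ^ s ≤ 2 * (2 * E) ^ s := by
    by_cases hT : T = ∞
    · have : {j : ℤ | T ≤ 2 ^ (j + 1)} = ∅ :=
        eq_empty_of_forall_notMem fun j hj => zpow_two_ne_top _ (top_le_iff.1 (hT ▸ hj))
      simp [this]
    obtain ⟨i, hi1, hi2⟩ := ENNReal.exists_mem_Ioc_zpow (y := 2) (total_pos hθ0 hω).ne' hT (by simp)
      (by simp)
    have hsub : {j : ℤ | T ≤ 2 ^ (j + 1)} ⊆ Ici i := by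
      intro j hj
      by_contra hji
      have : (2 : ℝ≥0∞) ^ (j + 1) ≤ 2 ^ i :=
        ENNReal.zpow_le_of_le (by simp) (by have := not_le.1 (mt mem_Ici.2 hji); lia)
      exact absurd (hi1.trans_le (le_trans hj this)) (lt_irrefl _)
    calc _ ≤ (2 * ((2 : ℝ≥0∞) ^ i)⁻¹ ^ s) * eLpNorm h q μ ^ s := by
          gcongr
          refine le_trans (ENNReal.tsum_le_tsum fun j => ?_) (tsum_indicator_zpow_rpow_le hs i)
          exact indicator_le_indicator_of_subset hsub (fun _ => zero_le) j
      _ ≤ (2 * (2 * T⁻¹) ^ s) * eLpNorm h q μ ^ s := by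
          gcongr
          rw [ENNReal.inv_le_iff_inv_le, ENNReal.mul_inv (by simp) (by simp), inv_inv,
            mul_comm, ← div_eq_mul_inv]
          refine ENNReal.div_le_of_le_mul (hi2.trans_eq ?_)
          rw [zpow_two_add, zpow_one]
      _ = _ := by
          rw [mul_assoc, ← ENNReal.mul_rpow_of_nonneg _ _ hs0.le, hE, div_eq_mul_inv]
          congr 2
          ring
  have hsum : ∑' j : ℤ, ((2 ^ j)⁻¹ * sublevelNorm μ ρ (headNorm θ ω) q h j) ^ s ≤
      2 * I + 2 * (2 * E) ^ s := by
    refine (ENNReal.tsum_le_tsum hkey).trans ?_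
    rw [ENNReal.tsum_add, ENNReal.tsum_mul_left, ENNReal.tsum_mul_right, ← hI]
    gcongr
  have h2 : (2 : ℝ≥0∞) ^ (1 / s) ≤ 2 := by
    calc (2 : ℝ≥0∞) ^ (1 / s) ≤ 2 ^ (1 : ℝ) :=
          ENNReal.rpow_le_rpow_of_exponent_le (by simp) (by
            rw [div_le_one hs0]
            exact hs)
      _ = 2 := ENNReal.rpow_one _
  rw [eLpNorm_count_eq_tsum hθ'0 hst]
  calc _ ≤ (2 * I + 2 * (2 * E) ^ s) ^ (1 / s) := by gcongr
    _ ≤ (2 * I) ^ (1 / s) + (2 * (2 * E) ^ s) ^ (1 / s) :=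
        ENNReal.rpow_add_le_add_rpow _ _ (by positivity) (by
          rw [div_le_one hs0]
          exact hs)
    _ = 2 ^ (1 / s) * I ^ (1 / s) + 2 ^ (1 / s) * (2 * E) := by
        rw [ENNReal.mul_rpow_of_nonneg _ _ (by positivity),
          ENNReal.mul_rpow_of_nonneg 2 ((2 * E) ^ s) (by positivity), ← ENNReal.rpow_mul,
          mul_one_div_cancel hs0.ne', ENNReal.rpow_one]
    _ ≤ 4 * I ^ (1 / s) + 2 * (2 * E) := by
        gcongr
        exact h2.trans (by norm_num)
    _ = _ := by ring

end Stieltjes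

/-! ### Removal of the weight. -/

section Reduction

theorem measurable_eReal_abs : Measurable EReal.abs :=
  EReal.measurable_of_measurable_real (by
    simp only [EReal.abs_def]
    exact ENNReal.measurable_ofReal.comp measurable_id.norm)

theorem eReal_abs_coe_ennreal (a : ℝ≥0∞) : (a : EReal).abs = a := by
  rw [← EReal.coe_ennreal_eq_coe_ennreal_iff]
  rcases eq_or_ne a ∞ with rfl | ha
  · rfl
  · lift a to ℝ≥0 using ha
    change (((a : ℝ) : EReal).abs : EReal) = ((a : ℝ) : EReal)
    rw [EReal.coe_abs, NNReal.abs_eq]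

variable {n : ℕ} {p θ : ℝ≥0∞} {ω : ℝ → ℝ≥0∞} {v : Rn n → ℝ≥0∞}

theorem wNorm_eq_eLpNorm (hp0 : p ≠ 0) (hp : p ≠ ∞) (A : Set (Rn n)) (g : Rn n → ℝ≥0∞) :
    wNorm p A v g = eLpNorm (fun x => g x * v x ^ (1 / p.toReal)) p (volume.restrict A) := by
  have hp' := ENNReal.toReal_pos hp0 hp
  rw [wNorm, if_neg hp, eLpNorm_ennreal_eq hp0 hp]
  simp_rw [ENNReal.mul_rpow_of_nonneg _ _ hp'.le, ← ENNReal.rpow_mul, one_div_mul_cancel hp'.ne',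
    ENNReal.rpow_one]

/-- For `p > 1` this is the identity `1 - p' = -p'/p`; for `p = 1` the weight `v⁻¹` is already
`v^{-1/p}`. -/
theorem dualNorm_eq_eLpNorm (hp1 : 1 ≤ p) (hp : p ≠ ∞) (A : Set (Rn n)) (f : Rn n → EReal) :
    dualNorm p v A f = eLpNorm (fun x => (f x).abs * v x ^ (-(1 / p.toReal))) p.conjExponent
      (volume.restrict A) := by
  have hconj : ENNReal.HolderConjugate p p.conjExponent :=
    ENNReal.HolderConjugate.conjExponent hp1
  have hq0 := ENNReal.HolderConjugate.ne_zero p.conjExponent p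
  by_cases h1 : p = 1
  · have hq : p.conjExponent = ∞ := (ENNReal.HolderConjugate.eq_top_iff_eq_one _ p).2 h1
    rw [dualNorm, wNorm, if_pos hq, hq, eLpNorm_ennreal_top]
    simp [dualWeight, h1, ENNReal.rpow_neg_one]
  · have hq : p.conjExponent ≠ ∞ := (ENNReal.HolderConjugate.ne_top_iff_ne_one _ p).2 h1
    have hr := toReal_holderConjugate (p := p) (q := p.conjExponent) hp hq
    have he : -(1 / p.toReal) * p.conjExponent.toReal = 1 - p.conjExponent.toReal := by
      have h2 := hr.inv_add_inv_eq_one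
      have h3 := hr.symm.ne_zero
      have h4 : p.toReal⁻¹ = 1 - p.conjExponent.toReal⁻¹ := by linarith
      rw [one_div, h4]
      field_simp
      ring
    rw [dualNorm, wNorm, if_neg hq, eLpNorm_ennreal_eq hq0 hq]
    simp_rw [ENNReal.mul_rpow_of_nonneg _ _ hr.symm.nonneg, ← ENNReal.rpow_mul, he, dualWeight,
      if_neg h1]

theorem complMorreyNorm_eq_eLpNorm (hp0 : p ≠ 0) (hp : p ≠ ∞) (hθ0 : θ ≠ 0) (g : Rn n → EReal) :
    complMorreyNorm p θ ω v g = eLpNorm (fun r => ω r * tailNorm volume (fun x : Rn n => ‖x‖) p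
      (fun x => (g x).abs * v x ^ (1 / p.toReal)) r) θ (volume.restrict (Ioi 0)) := by
  rw [complMorreyNorm, wNorm_one_eq_eLpNorm hθ0]
  congr 1
  ext r
  rw [wNorm_eq_eLpNorm hp0 hp, tailNorm]
  congr 3
  ext x
  simp

theorem rpow_neg_mul_rpow (hv : IsWeight v) (a : ℝ) :
    ∀ᵐ x, v x ^ (-a) * v x ^ a = 1 := by
  filter_upwards [hv.2] with x hx
  rw [← ENNReal.rpow_add _ _ hx.1.ne' hx.2.ne, neg_add_cancel, ENNReal.rpow_zero]

theorem associateNorm_le (hp0 : p ≠ 0) (hp : p ≠ ∞) (hθ0 : θ ≠ 0) (hv : IsWeight v)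
    {f : Rn n → EReal} {B : ℝ≥0∞}
    (hB : ∀ k : Rn n → ℝ≥0∞, AEMeasurable k →
      eLpNorm (fun r => ω r * tailNorm volume (fun x : Rn n => ‖x‖) p k r) θ
        (volume.restrict (Ioi 0)) ≤ 1 →
      ∫⁻ x, (f x).abs * v x ^ (-(1 / p.toReal)) * k x ≤ B) :
    associateNorm (complMorreyNorm p θ ω v) f ≤ B := by
  refine iSup_le fun g => iSup_le fun hg => iSup_le fun hg1 => ?_
  rw [complMorreyNorm_eq_eLpNorm hp0 hp hθ0] at hg1
  refine le_trans (le_of_eq ?_) (hB _ ((measurable_eReal_abs.comp_aemeasurable hg).mul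
    (hv.1.pow_const _)) hg1)
  refine lintegral_congr_ae ?_
  filter_upwards [rpow_neg_mul_rpow hv (1 / p.toReal)] with x hx
  rw [EReal.abs_mul]
  calc _ = (f x).abs * (g x).abs * 1 := (mul_one _).symm
    _ = _ := by
      rw [← hx]
      simp only [Function.comp_apply, Pi.mul_apply]
      ring

/-- The competitor is `g = k v^{-1/p}`; positivity and finiteness of `v` a.e. give `|g| v^{1/p} =
k`. -/
theorem le_associateNorm (hp0 : p ≠ 0) (hp : p ≠ ∞) (hθ0 : θ ≠ 0) (hv : IsWeight v)
    (f : Rn n → EReal) {k : Rn n → ℝ≥0∞} (hk : AEMeasurable k)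
    (hk1 : eLpNorm (fun r => ω r * tailNorm volume (fun x : Rn n => ‖x‖) p k r) θ
        (volume.restrict (Ioi 0)) ≤ 1) :
    ∫⁻ x, (f x).abs * v x ^ (-(1 / p.toReal)) * k x ≤
      associateNorm (complMorreyNorm p θ ω v) f := by
  set g : Rn n → EReal := fun x => ((k x * v x ^ (-(1 / p.toReal)) : ℝ≥0∞) : EReal) with hg
  have hgm : AEMeasurable g := (hk.mul (hv.1.pow_const _)).coe_ereal_ennreal
  have hgk : ∀ᵐ x, (g x).abs * v x ^ (1 / p.toReal) = k x := by
    filter_upwards [rpow_neg_mul_rpow hv (1 / p.toReal)] with x hx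
    rw [hg, eReal_abs_coe_ennreal, mul_assoc, hx, mul_one]
  have hg1 : complMorreyNorm p θ ω v g ≤ 1 := by
    rw [complMorreyNorm_eq_eLpNorm hp0 hp hθ0]
    convert hk1 using 4 with r
    exact eLpNorm_congr_ae (ae_restrict_of_ae hgk)
  refine le_trans (le_of_eq ?_)
    (le_iSup_of_le g (le_iSup_of_le hgm (le_iSup_of_le hg1 le_rfl)))
  refine lintegral_congr fun x => ?_
  rw [EReal.abs_mul, hg, eReal_abs_coe_ennreal]
  ring

end Reduction

/-! ### The Euclidean norm as `ρ`, and the theorem. -/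

theorem volume_norm_eq {n : ℕ} (hn : 1 ≤ n) (s : ℝ) : volume {x : Rn n | ‖x‖ = s} = 0 := by
  have : Nonempty (Fin n) := ⟨⟨0, hn⟩⟩
  have h : {x : Rn n | ‖x‖ = s} = Metric.sphere 0 s := by ext; simp
  rw [h]
  exact Measure.addHaar_sphere volume 0 s

theorem ae_norm_pos {n : ℕ} (hn : 1 ≤ n) : ∀ᵐ x : Rn n, 0 < ‖x‖ := by
  have h : ∀ᵐ x : Rn n, ‖x‖ ≠ 0 := by rw [ae_iff]; simpa using volume_norm_eq hn 0
  filter_upwards [h] with x hx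
  exact lt_of_le_of_ne (norm_nonneg x) hx.symm

theorem exists_dual_representative {n : ℕ} {p : ℝ≥0∞} (hp1 : 1 ≤ p) (hp : p ≠ ∞)
    {v : Rn n → ℝ≥0∞} (hv : IsWeight v) {f : Rn n → EReal} (hf : AEMeasurable f) :
    ∃ h : Rn n → ℝ≥0∞, Measurable h ∧
      (∀ k : Rn n → ℝ≥0∞,
        ∫⁻ x, (f x).abs * v x ^ (-(1 / p.toReal)) * k x = ∫⁻ x, h x * k x) ∧
      (∀ t : ℝ, dualNorm p v (Metric.ball 0 t) f =
        eLpNorm h p.conjExponent (volume.restrict {x | ‖x‖ < t})) ∧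
      dualNorm p v univ f = eLpNorm h p.conjExponent volume := by
  have hm : AEMeasurable fun x => (f x).abs * v x ^ (-(1 / p.toReal)) :=
    (measurable_eReal_abs.comp_aemeasurable hf).mul (hv.1.pow_const _)
  refine ⟨hm.mk, hm.measurable_mk,
    fun k => lintegral_congr_ae (hm.ae_eq_mk.mul (ae_eq_refl k)), fun t => ?_, ?_⟩
  · rw [dualNorm_eq_eLpNorm hp1 hp, eLpNorm_congr_ae (ae_restrict_of_ae hm.ae_eq_mk)]
    congr 2
    ext x
    simp
  · rw [dualNorm_eq_eLpNorm hp1 hp, Measure.restrict_univ, eLpNorm_congr_ae hm.ae_eq_mk]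

end MorreyType

theorem mainTheorem8 (n : ℕ) (hn : 1 ≤ n) (p θ : ℝ≥0∞) (hp1 : 1 ≤ p) (hp : p < ∞)
    (hθ : 0 < θ) (ω : ℝ → ℝ≥0∞) (hω : MorreyType.OmegaCompl θ ω)
    (v : MorreyType.Rn n → ℝ≥0∞) (hv : MorreyType.IsWeight v) :
    (θ ≤ 1 → ∃ C : ℝ≥0, 0 < C ∧
      ∀ f : MorreyType.Rn n → EReal, AEMeasurable f volume →
        MorreyType.associateNorm (MorreyType.complMorreyNorm p θ ω v) f ≤
            C * (⨆ t ∈ Ioi (0 : ℝ),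
              MorreyType.dualNorm p v (Metric.ball 0 t) f * (MorreyType.headNorm θ ω t)⁻¹) ∧
        (⨆ t ∈ Ioi (0 : ℝ),
              MorreyType.dualNorm p v (Metric.ball 0 t) f * (MorreyType.headNorm θ ω t)⁻¹) ≤
            C * MorreyType.associateNorm (MorreyType.complMorreyNorm p θ ω v) f) ∧
    (1 < θ → ∃ C : ℝ≥0, 0 < C ∧
      ∀ f : MorreyType.Rn n → EReal, AEMeasurable f volume →
        MorreyType.associateNorm (MorreyType.complMorreyNorm p θ ω v) f ≤
            C * ((∫⁻ t : Ioi (0 : ℝ),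
                  MorreyType.dualNorm p v (Metric.ball 0 (t : ℝ)) f ^ θ.conjExponent.toReal
                  ∂(MorreyType.stieltjesMeasure (MorreyType.negHeadPower θ ω))) ^
                    (1 / θ.conjExponent.toReal) +
                MorreyType.dualNorm p v univ f / MorreyType.wNorm θ (Ioi (0 : ℝ)) 1 ω) ∧
        (∫⁻ t : Ioi (0 : ℝ),
              MorreyType.dualNorm p v (Metric.ball 0 (t : ℝ)) f ^ θ.conjExponent.toReal
              ∂(MorreyType.stieltjesMeasure (MorreyType.negHeadPower θ ω))) ^
                (1 / θ.conjExponent.toReal) +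
            MorreyType.dualNorm p v univ f / MorreyType.wNorm θ (Ioi (0 : ℝ)) 1 ω ≤
          C * MorreyType.associateNorm (MorreyType.complMorreyNorm p θ ω v) f) := by
  have hp0 : p ≠ 0 := (zero_lt_one.trans_le hp1).ne'
  have hpt := hp.ne
  have hθ0 := hθ.ne'
  have hconj : ENNReal.HolderConjugate p p.conjExponent :=
    ENNReal.HolderConjugate.conjExponent hp1
  have hρ : Measurable fun x : MorreyType.Rn n => ‖x‖ := measurable_norm
  have hρ0 := MorreyType.ae_norm_pos hn
  have hρs := MorreyType.volume_norm_eq hn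
  constructor
  · intro hθ1
    obtain ⟨C, hC⟩ := MorreyType.exists_lintegral_mul_le_iSup (p := p) (q := p.conjExponent)
      hθ0 hθ1 hω hρ hρ0 hρs
    refine ⟨C + 1, by positivity, fun f hf => ?_⟩
    obtain ⟨h, hh, hfh, hball, -⟩ := MorreyType.exists_dual_representative hp1 hpt hv hf
    simp only [hball]
    constructor
    · refine MorreyType.associateNorm_le hp0 hpt hθ0 hv fun k hk hk1 => ?_
      rw [hfh k]
      refine (hC h k hh.aemeasurable hk hk1).trans ?_
      gcongr
      exact le_self_add
    · refine iSup₂_le fun t ht => ?_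
      rw [← div_eq_mul_inv]
      refine ENNReal.div_le_of_le_mul ((MorreyType.eLpNorm_ball_le_mul_headNorm (p := p)
        (c := MorreyType.associateNorm (MorreyType.complMorreyNorm p θ ω v) f)
        hθ0 hω hρ hh (fun k hk hk1 => ?_) ht).trans ?_)
      · exact (hfh k).symm.le.trans
          (MorreyType.le_associateNorm hp0 hpt hθ0 hv f hk.aemeasurable hk1)
      · gcongr
        exact le_mul_of_one_le_left' (by push_cast; exact le_add_self)
  · intro hθ1
    obtain ⟨C, hC⟩ := MorreyType.exists_lintegral_mul_le_eLpNorm_sublevelNorm (p := p)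
      (q := p.conjExponent) hθ1 hω hρ hρ0
    -- The upper bound needs `4 * C`. In the lower bound the two summands cost `2 + 2`, and the
    -- discrete sum is at most 4 times the associate norm, which gives 16.
    refine ⟨4 * C + 16, by positivity, fun f hf => ?_⟩
    obtain ⟨h, hh, hfh, hball, huniv⟩ := MorreyType.exists_dual_representative hp1 hpt hv hf
    simp only [hball, huniv, MorreyType.wNorm_one_eq_eLpNorm hθ0]
    constructor
    · refine MorreyType.associateNorm_le hp0 hpt hθ0 hv fun k hk hk1 => ?_
      rw [hfh k]
      refine (hC h k hh.aemeasurable hk hk1).trans ?_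
      refine (mul_le_mul_right (MorreyType.sublevel_le_stieltjes_add_total hθ1 hω h hρ0 hρs)
        _).trans ?_
      rw [← mul_assoc]
      gcongr
      push_cast
      rw [mul_comm]
      exact le_self_add
    · have hQ := MorreyType.eLpNorm_sublevelNorm_le (p := p) (q := p.conjExponent)
        (c := MorreyType.associateNorm (MorreyType.complMorreyNorm p θ ω v) f)
        hp1 hθ1 hω hρ hρ0 hρs hh fun k hk hk1 => by
          exact (hfh k).symm.le.trans
            (MorreyType.le_associateNorm hp0 hpt hθ0 hv f hk.aemeasurable hk1)
      refine (add_le_add (MorreyType.stieltjes_le_sublevel hθ1 hω h hρ0)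
        (MorreyType.total_le_sublevel (ρ := fun x : MorreyType.Rn n => ‖x‖) hθ1 hω h)).trans ?_
      rw [← two_mul, ← mul_assoc]
      refine (mul_le_mul_right hQ _).trans ?_
      rw [← mul_assoc]
      gcongr
      push_cast
      refine le_trans ?_ le_add_self
      norm_num
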